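/- Let $d\ge 1$. For $n\ge 1$ let $B_n$ be the braid group with the standard generators $\sigma_1,\dots,\sigma_{n-1}$, let $\epsilon:B_n\to\mathbb Z$ be the exponent sum, and for $\alpha\in B_n$ let $\alpha^*$ be its mirror image, i.e. the image of $\alpha$ under the automorphism $\sigma_i\mapsto\sigma_i^{-1}$. Let $\widehat\alpha$ denote the closure of $\alpha$; the closure $\widehat{\alpha^*}$ is the mirror image of $\widehat\alpha$. Let $\mathcal F_{d,n}$ be the modular framed braid group, generated by $\sigma_1,\dots,\sigma_{n-1},t_1,\dots,t_n$ with the braid relations, $t_it_j=t_jt_i$, $t_j\sigma_i=\sigma_i t_{s_i(j)}$ (with $s_i$ the transposition $(i,i+1)$) and $t_j^d=1$. For $q\in\mathbb C\setminus\{0\}$ the Yokonuma--Hecke algebra $Y_{d,n}(q)$ is the quotient of $\mathbb C\mathcal F_{d,n}$ by the two-sided ideal generated by the elements $\sigma_i^2-1-(q-q^{-1})e_i\sigma_i$ $(1\le i\le n-1)$, where $e_i=\frac1d\sum_{s=1}^d t_i^{s}t_{i+1}^{-s}$. Write $g_i$ for the image of $\sigma_i$, and $\delta:B_n\to Y_{d,n}(q)$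 for the homomorphism $\sigma_i\mapsto g_i$. Let $X_D=(\mathrm x_1,\dots,\mathrm x_{d-1})\in\mathbb C^{d-1}$ be a solution of the E-system (such solutions are parametrized by the non-empty subsets $D$ of $\mathbb Z/d\mathbb Z$): with $\mathrm x_0=1$, subscripts modulo $d$, and $E^{(m)}=\frac1d\sum_{s=0}^{d-1}\mathrm x_{m+s}\mathrm x_{d-s}$, one has $E^{(m)}=\mathrm x_mE^{(0)}$ for $1\le m\le d-1$. Let $\mathrm{tr}_{d,D}:\bigcup_nY_{d,n}(q)\to\mathbb C[z]$ be the specialized trace, i.e. the unique linear map such that for all $n\geq 1$ 1. $\mathrm{tr}_{d,D}(ab)=\mathrm{tr}_{d,D}(ba)$ for $a,b\in Y_{d,n}(q)$; 2. $\mathrm{tr}_{d,D}(1)=1$; 3. $\mathrm{tr}_{d,D}(a g_n)=z\,\mathrm{tr}_{d,D}(a)$ for $a\in Y_{d,n}(q)$; 4. $\mathrm{tr}_{d,D}(a t_{n+1}^s)=\mathrm x_s\,\mathrm{tr}_{d,D}(a)$ for $a\in Y_{d,n}(q)$ and $1\le s\le d-1$; and likewise $\mathrm{tr}_{d,D}(t_1^s)=\mathrm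 x_s$ for $1\le s\le d-1$. Put $E_D=E^{(0)}=\mathrm{tr}_{d,D}(e_i)$. For $z\in\mathbb C$, $z\ne0$, put $$\lambda_D=\frac{z-(q-q^{-1})E_D}{z},$$ and, if $\lambda_D\ne0$ and a square root $\sqrt{\lambda_D}$ has been chosen, put $$\Lambda_D=\frac1{z\sqrt{\lambda_D}},\qquad \Theta_{d,D}(q,z)(\widehat\alpha)=\Lambda_D^{\,n-1}\,(\sqrt{\lambda_D})^{\epsilon(\alpha)}\;\mathrm{tr}_{d,D}(\delta(\alpha))\qquad(\alpha\in B_n),$$ the trace being evaluated at $z$. For $q^2\ne1$ and $\lambda_D\ne0,1$ write $\Theta_{d,D}(q,\lambda_D)$ for the same quantity in the variables $(q,\lambda_D)$, that is, at $z=\dfrac{(q-q^{-1})E_D}{1-\lambda_D}$. **Proposition.** Let $X_D$ be a solution of the E-system and let $\alpha\in B_n$. (i) Let $q,z\in\mathbb C\setminus\{0\}$ with $z\ne(q-q^{-1})E_D$, and let $\sqrt{\lambda_D}$ be a square root of $\lambda_D=\lambda_D(q,z)$. The value of $\lambda_D$ at $(q^{-1},z-(q-q^{-1})E_D)$ is $\lambda_D^{-1}$;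 taking $1/\sqrt{\lambda_D}$ as its square root, $$\Theta_{d,D}(q,z)(\widehat{\alpha^*})=\Theta_{d,D}\bigl(q^{-1},\,z-(q-q^{-1})E_D\bigr)(\widehat\alpha).$$ (ii) Equivalently, in the variables $(q,\lambda_D)$: for $q\in\mathbb C\setminus\{0\}$ with $q^2\ne1$, $\lambda_D\in\mathbb C\setminus\{0,1\}$, and any square root $\sqrt{\lambda_D}$, with $1/\sqrt{\lambda_D}$ as the square root of $\lambda_D^{-1}$, $$\Theta_{d,D}(q,\lambda_D)(\widehat{\alpha^*})=\Theta_{d,D}(q^{-1},\lambda_D^{-1})(\widehat\alpha).$$ -/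

import Mathlib

open scoped Polynomial

noncomputable section

namespace YH

/-! ### Braid groups -/

/-- The generators `σ_i` of the braid group on `n` strands. Strands are numbered `0, …, n - 1`, and
`σ_i` involves the strands `i` and `i + 1`. -/
abbrev BraidGen (n : ℕ) : Type := {i : ℕ // i + 1 < n}

/-- The braid relations. -/
inductive BraidRel (n : ℕ) : FreeGroup (BraidGen n) → Prop
  | braid (i j : BraidGen n) (h : i.1 + 1 = j.1 ∨ j.1 + 1 = i.1) :
      BraidRel n (.of i * .of j * .of i * (.of j * .of i * .of j)⁻¹)
  | far (i j : BraidGen n) (h : i.1 + 1 < j.1 ∨ j.1 + 1 < i.1) :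
      BraidRel n (.of i * .of j * (.of j * .of i)⁻¹)

/-- The classical braid group `B_n`. -/
abbrev BraidGroup (n : ℕ) : Type := PresentedGroup {r | BraidRel n r}

/-- The braid generator `σ_i` as an element of `B_n`. -/
def σ {n : ℕ} (i : BraidGen n) : BraidGroup n := PresentedGroup.of i

theorem σ_braid {n : ℕ} (i j : BraidGen n) (h : i.1 + 1 = j.1 ∨ j.1 + 1 = i.1) :
    σ i * σ j * σ i = σ j * σ i * σ j :=
  PresentedGroup.mk_eq_mk_of_mul_inv_mem (BraidRel.braid i j h)

theorem σ_far {n : ℕ} (i j : BraidGen n) (h : i.1 + 1 < j.1 ∨ j.1 + 1 < i.1) :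
    σ i * σ j = σ j * σ i :=
  PresentedGroup.mk_eq_mk_of_mul_inv_mem (BraidRel.far i j h)

/-- A group homomorphism out of `B_n`, given by the images of the generators. -/
def BraidGroup.lift {n : ℕ} {G : Type*} [Group G] (f : BraidGen n → G)
    (hb : ∀ i j : BraidGen n, i.1 + 1 = j.1 ∨ j.1 + 1 = i.1 → f i * f j * f i = f j * f i * f j)
    (hf : ∀ i j : BraidGen n, i.1 + 1 < j.1 ∨ j.1 + 1 < i.1 → f i * f j = f j * f i) :
    BraidGroup n →* G :=
  PresentedGroup.toGroup (f := f) (by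
    rintro r (⟨i, j, h⟩ | ⟨i, j, h⟩)
    · simp [hb i j h]
    · simp [hf i j h])

@[simp] theorem BraidGroup.lift_σ {n : ℕ} {G : Type*} [Group G] (f : BraidGen n → G) (hb) (hf)
    (i : BraidGen n) : BraidGroup.lift f hb hf (σ i) = f i :=
  PresentedGroup.toGroup.of _

/-- The mirror image `α ↦ α^*`: the endomorphism of `B_n` with `σ_i ↦ σ_i⁻¹`. -/
def mirror (n : ℕ) : BraidGroup n →* BraidGroup n :=
  BraidGroup.lift (fun i => (σ i)⁻¹)
    (fun i j h => by simpa [mul_assoc] using congrArg (·⁻¹) (σ_braid i j h))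
    (fun i j h => by simpa using congrArg (·⁻¹) (σ_far j i h.symm))

/-- The exponent sum, as a homomorphism to the (multiplicative) group of integers. -/
def exponentSumHom (n : ℕ) : BraidGroup n →* Multiplicative ℤ :=
  BraidGroup.lift (fun _ => Multiplicative.ofAdd 1) (fun _ _ _ => rfl) (fun _ _ _ => rfl)

/-- The algebraic sum `ε(α)` of the exponents of the generators `σ_i` in the braid `α`. -/
def exponentSum {n : ℕ} (α : BraidGroup n) : ℤ := Multiplicative.toAdd (exponentSumHom n α)

/-! ### The modular framed braid group -/

/-- The generators of the (modular) framed braid group: the braiding generators `σ_i` and the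
framing generators `t_j`. -/
inductive FramedGen (n : ℕ) : Type
  | sigma (i : BraidGen n) : FramedGen n
  | twist (j : Fin n) : FramedGen n

/-- The relations of the modular framed braid group. -/
inductive FramedRel (d n : ℕ) : FreeGroup (FramedGen n) → Prop
  | braid (i j : BraidGen n) (h : i.1 + 1 = j.1 ∨ j.1 + 1 = i.1) :
      FramedRel d n (.of (.sigma i) * .of (.sigma j) * .of (.sigma i) *
        (.of (.sigma j) * .of (.sigma i) * .of (.sigma j))⁻¹)
  | far (i j : BraidGen n) (h : i.1 + 1 < j.1 ∨ j.1 + 1 < i.1) :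
      FramedRel d n (.of (.sigma i) * .of (.sigma j) * (.of (.sigma j) * .of (.sigma i))⁻¹)
  | twist_comm (i j : Fin n) :
      FramedRel d n (.of (.twist i) * .of (.twist j) * (.of (.twist j) * .of (.twist i))⁻¹)
  | twist_sigma (i : BraidGen n) (j k : Fin n) (h : k.1 = Equiv.swap i.1 (i.1 + 1) j.1) :
      FramedRel d n (.of (.twist j) * .of (.sigma i) * (.of (.sigma i) * .of (.twist k))⁻¹)
  | modular (j : Fin n) : FramedRel d n (.of (.twist j) ^ d)

/-- The modular framed braid group `F_{d,n} ≅ (ℤ/dℤ)^n ⋊ B_n`. -/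
abbrev FramedBraidGroup (d n : ℕ) : Type := PresentedGroup {r | FramedRel d n r}

/-- The generator `σ_i` of `F_{d,n}`. -/
def fσ (d : ℕ) {n : ℕ} (i : BraidGen n) : FramedBraidGroup d n := PresentedGroup.of (.sigma i)

/-- The generator `t_j` of `F_{d,n}`: framing `1` on the strand `j`. -/
def ft (d : ℕ) {n : ℕ} (j : Fin n) : FramedBraidGroup d n := PresentedGroup.of (.twist j)

theorem fσ_braid {d n : ℕ} (i j : BraidGen n) (h : i.1 + 1 = j.1 ∨ j.1 + 1 = i.1) :
    fσ d i * fσ d j * fσ d i = fσ d j * fσ d i * fσ d j :=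
  PresentedGroup.mk_eq_mk_of_mul_inv_mem (FramedRel.braid i j h)

theorem fσ_far {d n : ℕ} (i j : BraidGen n) (h : i.1 + 1 < j.1 ∨ j.1 + 1 < i.1) :
    fσ d i * fσ d j = fσ d j * fσ d i :=
  PresentedGroup.mk_eq_mk_of_mul_inv_mem (FramedRel.far i j h)

theorem ft_comm {d n : ℕ} (i j : Fin n) : ft d i * ft d j = ft d j * ft d i :=
  PresentedGroup.mk_eq_mk_of_mul_inv_mem (FramedRel.twist_comm i j)

theorem ft_fσ {d n : ℕ} (i : BraidGen n) (j k : Fin n)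
    (h : k.1 = Equiv.swap i.1 (i.1 + 1) j.1) : ft d j * fσ d i = fσ d i * ft d k :=
  PresentedGroup.mk_eq_mk_of_mul_inv_mem (FramedRel.twist_sigma i j k h)

theorem ft_pow {d n : ℕ} (j : Fin n) : ft d j ^ d = 1 :=
  PresentedGroup.one_of_mem (FramedRel.modular j)

/-- The natural homomorphism `B_n → F_{d,n}`: all framings are zero. -/
def braidToFramed (d n : ℕ) : BraidGroup n →* FramedBraidGroup d n :=
  BraidGroup.lift (fun i => fσ d i) (fun i j h => fσ_braid i j h) (fun i j h => fσ_far i j h)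

/-! ### The Yokonuma--Hecke algebra -/

section Algebra

variable (R : Type) [CommRing R] [Algebra ℂ R]

/-- The left strand of the generator `σ_i`. -/
def BraidGen.left {n : ℕ} (i : BraidGen n) : Fin n := ⟨i.1, by have := i.2; omega⟩

/-- The right strand of the generator `σ_i`. -/
def BraidGen.right {n : ℕ} (i : BraidGen n) : Fin n := ⟨i.1 + 1, i.2⟩

/-- The element `e_i = (1/d) ∑_{1 ≤ s ≤ d} t_i^s t_{i+1}^{-s}` of the group algebra of `F_{d,n}`. -/
def idem (d : ℕ) {n : ℕ} (i : BraidGen n) : MonoidAlgebra R (FramedBraidGroup d n) :=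
  algebraMap ℂ R (d : ℂ)⁻¹ • ∑ s ∈ Finset.Icc 1 d,
    MonoidAlgebra.of R _ (ft d i.left ^ s * (ft d i.right ^ s)⁻¹)

/-- The quadratic relations `σ_i ^ 2 = 1 + (q - q⁻¹) e_i σ_i` in the group algebra of `F_{d,n}`. -/
inductive QuadRel (d n : ℕ) (q : Rˣ) :
    MonoidAlgebra R (FramedBraidGroup d n) → MonoidAlgebra R (FramedBraidGroup d n) → Prop
  | quad (i : BraidGen n) :
      QuadRel d n q (MonoidAlgebra.of R _ (fσ d i) ^ 2)
        (1 + ((q : R) - ((q⁻¹ : Rˣ) : R)) • (idem R d i * MonoidAlgebra.of R _ (fσ d i)))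

/-- The Yokonuma--Hecke algebra `Y_{d,n}(q)` with coefficients in a commutative `ℂ`-algebra `R`: the
quotient of the group algebra of `F_{d,n}` by the two-sided ideal generated by the elements
`σ_i ^ 2 - 1 - (q - q⁻¹) e_i σ_i`. -/
def Y (d n : ℕ) (q : Rˣ) : Type := RingQuot (QuadRel R d n q)

instance (d n : ℕ) (q : Rˣ) : Ring (Y R d n q) := inferInstanceAs (Ring (RingQuot (QuadRel R d n q)))

instance (S : Type) [CommSemiring S] [Algebra S R] (d n : ℕ) (q : Rˣ) : Algebra S (Y R d n q) :=
  inferInstanceAs (Algebra S (RingQuot (QuadRel R d n q)))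

instance (S T : Type) [CommSemiring S] [CommSemiring T] [SMul S T] [Algebra S R] [Algebra T R]
    [IsScalarTower S T R] (d n : ℕ) (q : Rˣ) : IsScalarTower S T (Y R d n q) :=
  inferInstanceAs (IsScalarTower S T (RingQuot (QuadRel R d n q)))

/-- The quotient map from the group algebra. -/
def mkY (d n : ℕ) (q : Rˣ) : MonoidAlgebra R (FramedBraidGroup d n) →ₐ[R] Y R d n q :=
  RingQuot.mkAlgHom R (QuadRel R d n q)

/-- The natural map `F_{d,n} → Y_{d,n}(q)`. -/
def framedToY (d n : ℕ) (q : Rˣ) : FramedBraidGroup d n →* Y R d n q :=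
  (mkY R d n q : _ →* Y R d n q).comp (MonoidAlgebra.of R _)

/-- The natural map `B_n → Y_{d,n}(q)`, `σ_i ↦ g_i`. -/
def braidToY (d n : ℕ) (q : Rˣ) : BraidGroup n →* Y R d n q :=
  (framedToY R d n q).comp (braidToFramed d n)

variable {R} {d n : ℕ} {q : Rˣ}

/-- The generator `g_i` of `Y_{d,n}(q)`. -/
def g (d : ℕ) {n : ℕ} (q : Rˣ) (i : BraidGen n) : Y R d n q := framedToY R d n q (fσ d i)

/-- The generator `t_j` of `Y_{d,n}(q)`. -/
def t (d : ℕ) {n : ℕ} (q : Rˣ) (j : Fin n) : Y R d n q := framedToY R d n q (ft d j)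

/-! ### Representations of the generators -/

theorem t_comm (i j : Fin n) : t d q i * t d q j = t d q j * t d q i := by
  simp only [t, ← map_mul, ft_comm]

theorem t_pow (j : Fin n) : t d q j ^ d = 1 := by
  simp only [t, ← map_pow, ft_pow, map_one]

theorem t_inv (j : Fin n) (s : ℕ) (hs : s ≤ d) :
    framedToY R d n q (ft d j ^ s)⁻¹ = t d q j ^ (d - s) := by
  have : (ft d j ^ s)⁻¹ = ft d j ^ (d - s) := by
    rw [inv_eq_iff_mul_eq_one, ← pow_add, Nat.add_sub_cancel' hs, ft_pow]
  rw [this, map_pow, t]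

theorem pow_val_add {d : ℕ} [NeZero d] {B : Type} [Monoid B] {x : B} (hx : x ^ d = 1) (a b : ZMod d) :
    x ^ (a + b).val = x ^ a.val * x ^ b.val := by
  rw [← pow_add, ZMod.val_add, ← pow_mod_orderOf x, ← pow_mod_orderOf x (a.val + b.val)]
  congr 1
  exact Nat.mod_mod_of_dvd _ (orderOf_dvd_of_pow_eq_one hx)

theorem pow_val_natCast {d : ℕ} {B : Type} [Monoid B] {x : B} (hx : x ^ d = 1) (s : ℕ) :
    x ^ (s : ZMod d).val = x ^ s := by
  rw [ZMod.val_natCast, ← pow_mod_orderOf x, ← pow_mod_orderOf x s]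
  congr 1
  exact Nat.mod_mod_of_dvd _ (orderOf_dvd_of_pow_eq_one hx)

theorem pow_val_neg {d : ℕ} {B : Type} [Monoid B] {x : B} (hx : x ^ d = 1) (s : ℕ) (hs : s ≤ d) :
    x ^ (-(s : ZMod d)).val = x ^ (d - s) := by
  rw [← pow_val_natCast hx (d - s), Nat.cast_sub hs]
  simp

theorem sum_Icc_eq_sum_zmod {d : ℕ} [NeZero d] {M : Type*} [AddCommMonoid M] (f : ZMod d → M) :
    ∑ s ∈ Finset.Icc 1 d, f (s : ZMod d) = ∑ s : ZMod d, f s := by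
  have hd : 0 < d := Nat.pos_of_ne_zero (NeZero.ne d)
  refine Finset.sum_bij (fun s _ => (s : ZMod d)) (by simp) ?_ ?_ (by simp)
  · intro a ha b hb h
    simp only [Finset.mem_Icc] at ha hb
    have h' := (ZMod.natCast_eq_natCast_iff _ _ _).1 h
    rcases Nat.lt_or_ge a d with h1 | h1 <;> rcases Nat.lt_or_ge b d with h2 | h2
    · exact Nat.ModEq.eq_of_lt_of_lt h' h1 h2
    · have : b = d := by omega
      subst this
      have := (Nat.modEq_zero_iff_dvd).1 (h'.trans (by simp [Nat.ModEq]))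
      have := Nat.le_of_dvd (by omega) this
      omega
    · have : a = d := by omega
      subst this
      have := (Nat.modEq_zero_iff_dvd).1 (h'.symm.trans (by simp [Nat.ModEq]))
      have := Nat.le_of_dvd (by omega) this
      omega
    · omega
  · intro b _
    by_cases hb : b = 0
    · exact ⟨d, by simp; omega, by simp [hb]⟩
    · refine ⟨b.val, ?_, by simp⟩
      have := ZMod.val_lt b
      have h0 : b.val ≠ 0 := by simpa using hb
      simp; omega

/-- The scalar `1/d`. -/
def invd (R : Type) [CommRing R] [Algebra ℂ R] (d : ℕ) : R := algebraMap ℂ R (d : ℂ)⁻¹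

/-- The values of the standard character of `ℤ/dℤ`. -/
def chi (R : Type) [CommRing R] [Algebra ℂ R] {d : ℕ} [NeZero d] (a : ZMod d) : R :=
  algebraMap ℂ R (ZMod.stdAddChar a)

section Rep

variable {B : Type} [Ring B] [Algebra R B]

/-- The idempotent built from two commuting elements of order `d`. -/
def eB (R : Type) [CommRing R] [Algebra ℂ R] {B : Type} [Ring B] [Algebra R B]
    (d : ℕ) [NeZero d] (x y : B) : B :=
  invd R d • ∑ s : ZMod d, x ^ s.val * y ^ (-s).val

/-- Elements `g 0, …, g (n - 2)` and `t 0, …, t (n - 1)` satisfying the relations of the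
Yokonuma--Hecke algebra with parameter `v = q - q⁻¹`. -/
structure IsRep (d : ℕ) [NeZero d] (n : ℕ) (v : R) (g t : ℕ → B) : Prop where
  braid : ∀ i, i + 2 < n → g i * g (i + 1) * g i = g (i + 1) * g i * g (i + 1)
  far : ∀ i j, i + 1 < j → j + 1 < n → g i * g j = g j * g i
  tt : ∀ i j, i < n → j < n → t i * t j = t j * t i
  tg0 : ∀ i, i + 1 < n → t i * g i = g i * t (i + 1)
  tg1 : ∀ i, i + 1 < n → t (i + 1) * g i = g i * t i
  tg : ∀ i j, i + 1 < n → j < n → j ≠ i → j ≠ i + 1 → t j * g i = g i * t j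
  td : ∀ j, j < n → t j ^ d = 1
  quad : ∀ i, i + 1 < n → g i * g i = 1 + v • (eB R d (t i) (t (i + 1)) * g i)

section
variable [NeZero d]

theorem mkAlgHom_idem (i : BraidGen n) :
    mkY R d n q (idem R d i) =
      eB R d (t d q i.left : Y R d n q) (t d q i.right) := by
  rw [eB, idem, map_smul, map_sum, invd, ← sum_Icc_eq_sum_zmod]
  congr 1
  refine Finset.sum_congr rfl fun s hs => ?_
  have hs' : s ≤ d := (Finset.mem_Icc.1 hs).2
  change framedToY R d n q _ = _
  rw [map_mul, t_inv _ _ hs', map_pow, pow_val_natCast (t_pow _), pow_val_neg (t_pow _) _ hs']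
  rfl
/-- `g` on natural numbers, zero out of range. -/
def gT (d n : ℕ) (q : Rˣ) (i : ℕ) : Y R d n q := if h : i + 1 < n then g d q ⟨i, h⟩ else 0

/-- `t` on natural numbers, zero out of range. -/
def tT (d n : ℕ) (q : Rˣ) (j : ℕ) : Y R d n q := if h : j < n then t d q ⟨j, h⟩ else 0

theorem gT_eq (i : ℕ) (h : i + 1 < n) : gT d n q i = g d q ⟨i, h⟩ := dif_pos h

theorem tT_eq (j : ℕ) (h : j < n) : tT d n q j = t d q ⟨j, h⟩ := dif_pos h

theorem isRep_Y : IsRep (B := Y R d n q) d n ((q : R) - ((q⁻¹ : Rˣ) : R)) (gT d n q) (tT d n q) where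
  braid i h := by
    rw [gT_eq i (by omega), gT_eq (i + 1) (by omega)]
    simp only [g, ← map_mul]
    rw [fσ_braid _ _ (Or.inl rfl)]
  far i j h h' := by
    rw [gT_eq i (by omega), gT_eq j (by omega)]
    simp only [g, ← map_mul]
    rw [fσ_far _ _ (Or.inl h)]
  tt i j h h' := by
    rw [tT_eq i h, tT_eq j h', t_comm]
  tg0 i h := by
    rw [tT_eq i (by omega), tT_eq (i + 1) h, gT_eq i h]
    simp only [g, t, ← map_mul]
    rw [ft_fσ _ _ ⟨i + 1, h⟩ (by simp)]
  tg1 i h := by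
    rw [tT_eq i (by omega), tT_eq (i + 1) h, gT_eq i h]
    simp only [g, t, ← map_mul]
    rw [ft_fσ _ _ ⟨i, by omega⟩ (by simp)]
  tg i j h h' h1 h2 := by
    rw [tT_eq j h', gT_eq i h]
    simp only [g, t, ← map_mul]
    rw [ft_fσ _ _ ⟨j, h'⟩ (by simp [Equiv.swap_apply_of_ne_of_ne h1 h2])]
  td j h := by rw [tT_eq j h, t_pow]
  quad i h := by
    rw [tT_eq i (by omega), tT_eq (i + 1) h, gT_eq i h]
    have : mkY R d n q _ = mkY R d n q _ :=
      RingQuot.mkAlgHom_rel R (QuadRel.quad (d := d) (q := q) (⟨i, h⟩ : BraidGen n))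
    rw [map_pow, map_add, map_one, map_smul, map_mul, mkAlgHom_idem, pow_two] at this
    exact this

namespace IsRep

variable {v : R} {gg tt : ℕ → B}

theorem e_comm (H : IsRep d n v gg tt) (i : ℕ) (h : i + 1 < n) :
    eB R d (tt i) (tt (i + 1)) * gg i = gg i * eB R d (tt i) (tt (i + 1)) := by
  have h0 : ∀ s : ℕ, tt i ^ s * gg i = gg i * tt (i + 1) ^ s := fun s => by
    have : SemiconjBy (gg i) (tt (i + 1)) (tt i) := (H.tg0 i h).symm
    exact (this.pow_right s).symm
  have h1 : ∀ s : ℕ, tt (i + 1) ^ s * gg i = gg i * tt i ^ s := fun s => by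
    have : SemiconjBy (gg i) (tt i) (tt (i + 1)) := (H.tg1 i h).symm
    exact (this.pow_right s).symm
  rw [eB, smul_mul_assoc, mul_smul_comm, Finset.sum_mul, Finset.mul_sum]
  congr 1
  refine Fintype.sum_equiv (Equiv.neg _) _ _ fun s => ?_
  have hc : Commute (tt (i + 1)) (tt i) := H.tt _ _ h (by omega)
  simp only [Equiv.neg_apply, neg_neg]
  rw [mul_assoc, h1, ← mul_assoc, h0, mul_assoc, (hc.pow_pow _ _).eq]

/-- The generators are invertible. -/
def unit (H : IsRep d n v gg tt) (i : ℕ) (h : i + 1 < n) : Bˣ where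
  val := gg i
  inv := gg i - v • eB R d (tt i) (tt (i + 1))
  val_inv := by
    rw [mul_sub, H.quad i h, mul_smul_comm, H.e_comm i h]; simp
  inv_val := by
    rw [sub_mul, H.quad i h, smul_mul_assoc]; simp

/-- The framing generators are invertible. -/
def tunit (H : IsRep d n v gg tt) (j : ℕ) (h : j < n) : Bˣ := Units.ofPowEqOne (tt j) d (H.td j h) (NeZero.ne d)

/-- The homomorphism from the framed braid group given by a representation. -/
def groupHom (H : IsRep d n v gg tt) : FramedBraidGroup d n →* Bˣ :=
  PresentedGroup.toGroup
    (f := fun x => match x with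
      | .sigma i => H.unit i.1 i.2
      | .twist j => H.tunit j.1 j.2) (by
    rintro r (⟨i, j, h⟩ | ⟨i, j, h⟩ | ⟨i, j⟩ | ⟨⟨i, hi⟩, ⟨j, hj⟩, ⟨k, hk⟩, h⟩ | ⟨j⟩)
    · simp only [map_mul, map_inv, FreeGroup.lift_apply_of, mul_inv_eq_one]
      ext
      simp only [Units.val_mul, unit]
      rcases h with h | h
      · rw [← h]; exact H.braid _ (by have := j.2; omega)
      · rw [← h]; exact (H.braid _ (by have := i.2; omega)).symm
    · simp only [map_mul, map_inv, FreeGroup.lift_apply_of, mul_inv_eq_one]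
      ext
      simp only [Units.val_mul, unit]
      rcases h with h | h
      · exact H.far _ _ h j.2
      · exact (H.far _ _ h i.2).symm
    · simp only [map_mul, map_inv, FreeGroup.lift_apply_of, mul_inv_eq_one]
      ext
      exact H.tt _ _ i.2 j.2
    · simp only [map_mul, map_inv, FreeGroup.lift_apply_of, mul_inv_eq_one]
      ext
      change tt j * gg i = gg i * tt k
      simp only at h
      by_cases h1 : j = i
      · subst h1; simp at h; subst h; exact H.tg0 _ hi
      by_cases h2 : j = i + 1
      · subst h2; simp at h; subst h; exact H.tg1 _ hi
      · rw [Equiv.swap_apply_of_ne_of_ne h1 h2] at h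
        subst h; exact H.tg _ _ hi hj h1 h2
    · simp only [map_pow, FreeGroup.lift_apply_of]
      ext
      simp [tunit])

end IsRep

/-- The universal property of the Yokonuma--Hecke algebra. -/
def Y.lift {gg tt : ℕ → B} (H : IsRep d n ((q : R) - ((q⁻¹ : Rˣ) : R)) gg tt) : Y R d n q →ₐ[R] B :=
  RingQuot.liftAlgHom R ⟨MonoidAlgebra.lift R B _ ((Units.coeHom B).comp H.groupHom), by
    rintro _ _ ⟨i⟩
    have hg : MonoidAlgebra.lift R B _ ((Units.coeHom B).comp H.groupHom)
        (MonoidAlgebra.of R _ (fσ d i)) = gg i.1 := by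
      rw [MonoidAlgebra.lift_of, MonoidHom.comp_apply, IsRep.groupHom, fσ, PresentedGroup.toGroup.of]
      rfl
    have ht : ∀ j : Fin n, H.groupHom (ft d j) = H.tunit j.1 j.2 := fun j => by
      rw [IsRep.groupHom, ft, PresentedGroup.toGroup.of]
    have hi : ∀ (j : Fin n) (s : ℕ), s ≤ d →
        (((H.tunit j.1 j.2) ^ s)⁻¹ : Bˣ) = (H.tunit j.1 j.2) ^ (d - s) := fun j s hs => by
      rw [inv_eq_iff_mul_eq_one, ← pow_add, Nat.add_sub_cancel' hs]
      ext
      simp [IsRep.tunit]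
    have he : MonoidAlgebra.lift R B _ ((Units.coeHom B).comp H.groupHom) (idem R d i) =
        eB R d (tt i.1) (tt (i.1 + 1)) := by
      rw [eB, idem, map_smul, map_sum, invd, ← sum_Icc_eq_sum_zmod]
      congr 1
      refine Finset.sum_congr rfl fun s hs => ?_
      have hs' : s ≤ d := (Finset.mem_Icc.1 hs).2
      rw [MonoidAlgebra.lift_of, MonoidHom.comp_apply, map_mul, map_inv, map_pow, map_pow, ht, ht,
        hi _ _ hs', pow_val_natCast (H.td i.1 (i.left).2),
        pow_val_neg (H.td (i.1 + 1) i.2) _ hs']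
      rfl
    rw [map_pow, hg, map_add, map_one, map_smul, map_mul, hg, he, pow_two, H.quad _ i.2]⟩

theorem Y.lift_g {gg tt : ℕ → B} (H : IsRep d n ((q : R) - ((q⁻¹ : Rˣ) : R)) gg tt)
    (i : BraidGen n) : Y.lift H (g d q i) = gg i.1 := by
  change Y.lift H (RingQuot.mkAlgHom R (QuadRel R d n q) (MonoidAlgebra.of R _ (fσ d i))) = _
  unfold Y.lift
  refine (RingQuot.liftAlgHom_mkAlgHom_apply R _ _ _).trans ?_
  rw [MonoidAlgebra.lift_of, MonoidHom.comp_apply,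
    IsRep.groupHom, fσ, PresentedGroup.toGroup.of]
  rfl

theorem Y.lift_t {gg tt : ℕ → B} (H : IsRep d n ((q : R) - ((q⁻¹ : Rˣ) : R)) gg tt)
    (j : Fin n) : Y.lift H (t d q j) = tt j.1 := by
  change Y.lift H (RingQuot.mkAlgHom R (QuadRel R d n q) (MonoidAlgebra.of R _ (ft d j))) = _
  unfold Y.lift
  refine (RingQuot.liftAlgHom_mkAlgHom_apply R _ _ _).trans ?_
  rw [MonoidAlgebra.lift_of, MonoidHom.comp_apply,
    IsRep.groupHom, ft, PresentedGroup.toGroup.of]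
  rfl

theorem Y.lift_gT {gg tt : ℕ → B} (H : IsRep d n ((q : R) - ((q⁻¹ : Rˣ) : R)) gg tt)
    (i : ℕ) (h : i + 1 < n) : Y.lift H (gT d n q i) = gg i := by
  rw [gT_eq i h, Y.lift_g]

theorem Y.lift_tT {gg tt : ℕ → B} (H : IsRep d n ((q : R) - ((q⁻¹ : Rˣ) : R)) gg tt)
    (j : ℕ) (h : j < n) : Y.lift H (tT d n q j) = tt j := by
  rw [tT_eq j h, Y.lift_t]

theorem Y.hom_ext {f f' : Y R d n q →ₐ[R] B} (hg : ∀ i, i + 1 < n → f (gT d n q i) = f' (gT d n q i))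
    (ht : ∀ j, j < n → f (tT d n q j) = f' (tT d n q j)) : f = f' := by
  apply RingQuot.ringQuot_ext'
  apply MonoidAlgebra.algHom_ext'
  swap
  · ext
  have : ∀ F : Y R d n q →ₐ[R] B, (((F.comp (mkY R d n q)) :
      MonoidAlgebra R (FramedBraidGroup d n) →* B).comp (MonoidAlgebra.of R _)) =
      (F : Y R d n q →* B).comp (framedToY R d n q) := fun F => rfl
  change (((f.comp (mkY R d n q)) :
      MonoidAlgebra R (FramedBraidGroup d n) →* B).comp (MonoidAlgebra.of R _)) =
    (((f'.comp (mkY R d n q)) :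
      MonoidAlgebra R (FramedBraidGroup d n) →* B).comp (MonoidAlgebra.of R _))
  rw [this, this]
  have key : (f : Y R d n q →* B).comp (framedToY R d n q) =
      (f' : Y R d n q →* B).comp (framedToY R d n q) := by
    have : ((f : Y R d n q →* B).comp (framedToY R d n q)).toHomUnits =
        ((f' : Y R d n q →* B).comp (framedToY R d n q)).toHomUnits := by
      apply PresentedGroup.ext
      rintro (i | j)
      · ext
        have := hg i.1 i.2
        rw [gT_eq _ i.2] at this
        exact this
      · ext
        have := ht j.1 j.2
        rw [tT_eq _ j.2] at this
        exact this
    ext x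
    exact congrArg Units.val (DFunLike.congr_fun this x)
  exact key

theorem map_eB {B' : Type} [Ring B'] [Algebra R B'] (f : B →ₐ[R] B') (x y : B) :
    f (eB R d x y) = eB R d (f x) (f y) := by
  simp [eB]

theorem IsRep.of_injective {B' : Type} [Ring B'] [Algebra R B'] (f : B →ₐ[R] B')
    (hf : Function.Injective f) {v : R} {gg tt : ℕ → B}
    (H : IsRep d n v (fun i => f (gg i)) (fun j => f (tt j))) : IsRep d n v gg tt where
  braid i h := hf (by simpa using H.braid i h)
  far i j h h' := hf (by simpa using H.far i j h h')
  tt i j h h' := hf (by simpa using H.tt i j h h')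
  tg0 i h := hf (by simpa using H.tg0 i h)
  tg1 i h := hf (by simpa using H.tg1 i h)
  tg i j h h' h1 h2 := hf (by simpa using H.tg i j h h' h1 h2)
  td j h := hf (by simpa using H.td j h)
  quad i h := hf (by simpa [map_eB] using H.quad i h)

/-- Induction along the generators. -/
theorem Y.mem_of_gen (S : Subalgebra R (Y R d n q)) (hg : ∀ i, i + 1 < n → gT d n q i ∈ S)
    (ht : ∀ j, j < n → tT d n q j ∈ S) (y : Y R d n q) : y ∈ S := by
  have hg' : ∀ i, gT d n q i ∈ S := fun i => by
    by_cases h : i + 1 < n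
    · exact hg i h
    · rw [gT, dif_neg h]; exact S.zero_mem
  have ht' : ∀ i, tT d n q i ∈ S := fun i => by
    by_cases h : i < n
    · exact ht i h
    · rw [tT, dif_neg h]; exact S.zero_mem
  have H : IsRep (B := S) d n ((q : R) - ((q⁻¹ : Rˣ) : R)) (fun i => ⟨gT d n q i, hg' i⟩)
      (fun i => ⟨tT d n q i, ht' i⟩) :=
    IsRep.of_injective S.val Subtype.val_injective isRep_Y
  have : S.val.comp (Y.lift H) = AlgHom.id R _ :=
    Y.hom_ext (fun i h => by simp [Y.lift_gT H i h]) (fun j h => by simp [Y.lift_tT H j h])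
  have h2 := DFunLike.congr_fun this y
  simp only [AlgHom.comp_apply, AlgHom.id_apply] at h2
  rw [← h2]
  exact (Y.lift H y).2

/-! ### Identities between the generators -/

theorem chi_add (a b : ZMod d) : chi R (a + b) = chi R a * chi R b := by
  rw [chi, AddChar.map_add_eq_mul, map_mul]; rfl

theorem chi_zero : chi R (0 : ZMod d) = 1 := by
  rw [chi, AddChar.map_zero_eq_one, map_one]

theorem chi_nsmul (a : ZMod d) (s : ℕ) : chi R a ^ s = chi R ((s : ZMod d) * a) := by
  induction s with
  | zero => simp [chi_zero]
  | succ s ih => rw [pow_succ, ih, ← chi_add]; push_cast; ring_nf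

theorem sum_chi (a : ZMod d) :
    invd R d * ∑ s : ZMod d, chi R (s * a) = if a = 0 then 1 else 0 := by
  have h := AddChar.sum_mulShift a (ZMod.isPrimitive_stdAddChar d)
  simp only [chi, invd]
  rw [← map_sum, ← map_mul, h]
  have hd : (d : ℂ) ≠ 0 := Nat.cast_ne_zero.2 (NeZero.ne d)
  split_ifs
  · simp [ZMod.card, hd]
  · simp

/-- The projection onto the eigenspace of an element of order `d`. -/
def pB (R : Type) [CommRing R] [Algebra ℂ R] {B : Type} [Ring B] [Algebra R B]
    {d : ℕ} [NeZero d] (x : B) (a : ZMod d) : B :=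
  invd R d • ∑ s : ZMod d, chi R (-(s * a)) • x ^ s.val

theorem mul_pB {x : B} (hx : x ^ d = 1) (a : ZMod d) : x * pB R x a = chi R a • pB R x a := by
  rw [pB, mul_smul_comm, smul_comm (chi R a) (invd R d), Finset.mul_sum, Finset.smul_sum (r := chi R a)]
  congr 1
  refine Fintype.sum_equiv (Equiv.addRight (1 : ZMod d)) _ _ fun s => ?_
  have h1 : x = x ^ (1 : ZMod d).val := by
    have := pow_val_natCast hx 1
    rw [Nat.cast_one, pow_one] at this
    exact this.symm
  simp only [Equiv.coe_addRight]
  rw [pow_val_add hx, ← h1, smul_smul, ← chi_add, mul_smul_comm, ← pow_succ', ← pow_succ]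
  congr 2
  ring

theorem pow_mul_pB {x : B} (hx : x ^ d = 1) (a : ZMod d) (s : ℕ) :
    x ^ s * pB R x a = chi R ((s : ZMod d) * a) • pB R x a := by
  induction s with
  | zero => simp [chi_zero]
  | succ s ih =>
    rw [pow_succ, mul_assoc, mul_pB hx, mul_smul_comm, ih, smul_smul, ← chi_add]
    push_cast; ring_nf

theorem pow_val_mul_pB {x : B} (hx : x ^ d = 1) (a s : ZMod d) :
    x ^ s.val * pB R x a = chi R (s * a) • pB R x a := by
  rw [pow_mul_pB hx, ZMod.natCast_zmod_val]

theorem pB_idem {x : B} (hx : x ^ d = 1) (a : ZMod d) : pB R x a * pB R x a = pB R x a := by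
  have h : pB R x a * pB R x a =
      (invd R d * ∑ s : ZMod d, chi R (s * (0 : ZMod d))) • pB R x a := by
    conv_lhs => enter [1]; rw [pB]
    rw [smul_mul_assoc, Finset.sum_mul, mul_smul, Finset.sum_smul]
    congr 1
    refine Finset.sum_congr rfl fun s _ => ?_
    rw [smul_mul_assoc, pow_val_mul_pB hx, smul_smul, ← chi_add]
    congr 2
    ring
  rw [h, sum_chi, if_pos rfl, one_smul]

theorem sum_pB (x : B) : ∑ a : ZMod d, pB R x a = 1 := by
  simp only [pB]
  rw [← Finset.smul_sum, Finset.sum_comm]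
  have : ∀ s : ZMod d, invd R d • ∑ a : ZMod d, chi R (-(s * a)) • x ^ s.val =
      if s = 0 then 1 else 0 := fun s => by
    rw [← Finset.sum_smul, smul_smul]
    have h := sum_chi (R := R) (-s)
    have h2 : ∑ a : ZMod d, chi R (-(s * a)) = ∑ a : ZMod d, chi R (a * -s) :=
      Finset.sum_congr rfl fun a _ => by congr 1; ring
    rw [h2, h]
    by_cases hs : s = 0
    · simp [hs]
    · simp [hs]
  rw [Finset.smul_sum, Finset.sum_congr rfl fun s _ => this s]
  simp

theorem pB_semiconj {x y c : B} (h : SemiconjBy c x y) (a : ZMod d) :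
    SemiconjBy c (pB R x a) (pB R y a) := by
  simp only [SemiconjBy, pB]
  rw [mul_smul_comm, smul_mul_assoc, Finset.mul_sum, Finset.sum_mul]
  congr 1
  refine Finset.sum_congr rfl fun s _ => ?_
  rw [mul_smul_comm, smul_mul_assoc, (h.pow_right s.val).eq]

theorem pB_commute {x c : B} (h : Commute c x) (a : ZMod d) : Commute c (pB R x a) :=
  pB_semiconj h a

theorem eB_mul_pB_right {x y : B} (hy : y ^ d = 1)
    (a : ZMod d) : eB R d x y * pB R y a = pB R x a * pB R y a := by
  have h : pB R x a * pB R y a =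
      invd R d • ∑ s : ZMod d, (chi R (-(s * a)) • x ^ s.val) * pB R y a := by
    conv_lhs => enter [1]; rw [pB]
    rw [smul_mul_assoc, Finset.sum_mul]
  rw [h, eB, smul_mul_assoc, Finset.sum_mul]
  congr 1
  refine Finset.sum_congr rfl fun s _ => ?_
  rw [mul_assoc, pow_val_mul_pB hy, mul_smul_comm, smul_mul_assoc, neg_mul]

/-- The product `g_j g_{j+1} ⋯ g_{j+l-1}`. -/
def W (gg : ℕ → B) (j : ℕ) : ℕ → B
  | 0 => 1
  | l + 1 => W gg j l * gg (j + l)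

namespace IsRep

variable {v : R} {gg tt : ℕ → B}

theorem g_p0 (H : IsRep d n v gg tt) (i : ℕ) (h : i + 1 < n) (a : ZMod d) :
    gg i * pB R (tt (i + 1)) a = pB R (tt i) a * gg i :=
  (pB_semiconj (show SemiconjBy (gg i) (tt (i + 1)) (tt i) from (H.tg0 i h).symm) a).eq

theorem g_p1 (H : IsRep d n v gg tt) (i : ℕ) (h : i + 1 < n) (a : ZMod d) :
    gg i * pB R (tt i) a = pB R (tt (i + 1)) a * gg i :=
  (pB_semiconj (show SemiconjBy (gg i) (tt i) (tt (i + 1)) from (H.tg1 i h).symm) a).eq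

theorem g_p (H : IsRep d n v gg tt) (i j : ℕ) (h : i + 1 < n) (hj : j < n) (h1 : j ≠ i) (h2 : j ≠ i + 1) (a : ZMod d) :
    gg i * pB R (tt j) a = pB R (tt j) a * gg i :=
  (pB_commute (show Commute (gg i) (tt j) from (H.tg i j h hj h1 h2).symm) a).eq

theorem t_p (H : IsRep d n v gg tt) (i j : ℕ) (h : i < n) (hj : j < n) (a : ZMod d) :
    tt i * pB R (tt j) a = pB R (tt j) a * tt i :=
  (pB_commute (show Commute (tt i) (tt j) from H.tt i j h hj) a).eq

end IsRep

theorem W_succ' (gg : ℕ → B) (j l : ℕ) : W gg j (l + 1) = gg j * W gg (j + 1) l := by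
  induction l with
  | zero => simp [W]
  | succ l ih => rw [W, ih, W, mul_assoc]; congr 3; ring

theorem W_commute {gg : ℕ → B} {x : B} {j l : ℕ} (h : ∀ k, j ≤ k → k < j + l → Commute x (gg k)) :
    Commute x (W gg j l) := by
  induction l with
  | zero => exact Commute.one_right _
  | succ l ih =>
    exact (ih fun k h1 h2 => h k h1 (by omega)).mul_right (h _ (by omega) (by omega))

/-- The products `p_{j,a} g_j ⋯ g_{n-1}`. -/
def P (R : Type) [CommRing R] [Algebra ℂ R] {B : Type} [Ring B] [Algebra R B]
    {d : ℕ} [NeZero d] (gg tt : ℕ → B) (n j : ℕ) (a : ZMod d) : B :=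
  pB R (tt j) a * W gg j (n - j)

namespace IsRep

variable {v : R} {gg tt : ℕ → B}

theorem W_t_low (H : IsRep d (n + 1) v gg tt) {i j l : ℕ} (h : i < j) (hn : j + l ≤ n) : Commute (tt i) (W gg j l) :=
  W_commute fun k h1 h2 => H.tg k i (by omega) (by omega) (by omega) (by omega)

theorem W_t_high (H : IsRep d (n + 1) v gg tt) {i j l : ℕ} (h : j + l < i) (hn : i ≤ n) : Commute (tt i) (W gg j l) :=
  W_commute fun k h1 h2 => H.tg k i (by omega) (by omega) (by omega) (by omega)

theorem W_t_mid (H : IsRep d (n + 1) v gg tt) {i j l : ℕ} (h : j < i) (h' : i ≤ j + l) (hn : j + l ≤ n) :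
    tt i * W gg j l = W gg j l * tt (i - 1) := by
  induction l with
  | zero => omega
  | succ l ih =>
    rw [W]
    by_cases hi : i ≤ j + l
    · rw [← mul_assoc, ih hi (by omega), mul_assoc, mul_assoc,
        H.tg (j + l) (i - 1) (by omega) (by omega) (by omega) (by omega)]
    · have : i = j + l + 1 := by omega
      subst this
      rw [← mul_assoc, (H.W_t_high (by omega) (by omega)).eq, mul_assoc, mul_assoc,
        H.tg1 (j + l) (by omega)]
      rfl

theorem W_g_low (H : IsRep d (n + 1) v gg tt) {i j l : ℕ} (h : i + 1 < j) (hn : j + l ≤ n) : Commute (gg i) (W gg j l) :=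
  W_commute fun k h1 h2 => H.far i k (by omega) (by omega)

theorem W_g_high (H : IsRep d (n + 1) v gg tt) {i j l : ℕ} (h : j + l < i) (hn : i < n) : Commute (gg i) (W gg j l) :=
  W_commute fun k h1 h2 => (H.far k i (by omega) (by omega)).symm

theorem W_g_mid (H : IsRep d (n + 1) v gg tt) {i j l : ℕ} (h : j < i) (h' : i < j + l) (hn : j + l ≤ n) :
    gg i * W gg j l = W gg j l * gg (i - 1) := by
  induction l with
  | zero => omega
  | succ l ih =>
    rw [W]
    by_cases hi : i < j + l
    · rw [← mul_assoc, ih hi (by omega), mul_assoc, mul_assoc,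
        H.far (i - 1) (j + l) (by omega) (by omega)]
    · have : i = j + l := by omega
      subst this
      obtain ⟨l, rfl⟩ : ∃ m, l = m + 1 := ⟨l - 1, by omega⟩
      rw [W, show j + (l + 1) - 1 = j + l by omega, ← mul_assoc, ← mul_assoc,
        (H.W_g_high (by omega) (by omega)).eq, mul_assoc, mul_assoc, mul_assoc, mul_assoc]
      congr 1
      have := H.braid (j + l) (by omega)
      rw [← mul_assoc, ← mul_assoc, ← add_assoc, this]

theorem g_P_high (H : IsRep d (n + 1) v gg tt) (i j : ℕ) (h : j < i) (hi : i < n) (a : ZMod d) :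
    gg i * P R gg tt n j a = P R gg tt n j a * gg (i - 1) := by
  rw [P, ← mul_assoc, H.g_p i j (by omega) (by omega) (by omega) (by omega), mul_assoc,
    H.W_g_mid h (by omega) (by omega), mul_assoc]

theorem g_P_succ (H : IsRep d (n + 1) v gg tt) (i : ℕ) (hi : i < n) (a : ZMod d) :
    gg i * P R gg tt n (i + 1) a = P R gg tt n i a := by
  rw [P, P, ← mul_assoc, H.g_p0 i (by omega), mul_assoc, ← W_succ']
  congr 2; omega

theorem g_P_low (H : IsRep d (n + 1) v gg tt) (i j : ℕ) (h : i + 1 < j) (hj : j ≤ n) (a : ZMod d) :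
    gg i * P R gg tt n j a = P R gg tt n j a * gg i := by
  rw [P, ← mul_assoc, H.g_p i j (by omega) (by omega) (by omega) (by omega), mul_assoc,
    (H.W_g_low h (by omega)).eq, mul_assoc]

theorem t_P_eq (H : IsRep d (n + 1) v gg tt) (i : ℕ) (hi : i ≤ n) (a : ZMod d) :
    tt i * P R gg tt n i a = chi R a • P R gg tt n i a := by
  rw [P, ← mul_assoc, mul_pB (H.td i (by omega)), smul_mul_assoc]

theorem t_P_low (H : IsRep d (n + 1) v gg tt) (i j : ℕ) (h : i < j) (hj : j ≤ n) (a : ZMod d) :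
    tt i * P R gg tt n j a = P R gg tt n j a * tt i := by
  rw [P, ← mul_assoc, H.t_p i j (by omega) (by omega), mul_assoc,
    (H.W_t_low h (by omega)).eq, mul_assoc]

theorem t_P_high (H : IsRep d (n + 1) v gg tt) (i j : ℕ) (h : j < i) (hi : i ≤ n) (a : ZMod d) :
    tt i * P R gg tt n j a = P R gg tt n j a * tt (i - 1) := by
  rw [P, ← mul_assoc, H.t_p i j (by omega) (by omega), mul_assoc,
    H.W_t_mid h (by omega) (by omega), mul_assoc]

theorem g_P_eq (H : IsRep d (n + 1) v gg tt) (i : ℕ) (hi : i < n) (a : ZMod d) :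
    gg i * P R gg tt n i a =
      P R gg tt n (i + 1) a + v • (P R gg tt n i a * pB R (tt i) a) := by
  have hc : Commute (pB R (tt i) a) (W gg (i + 1) (n - (i + 1))) :=
    (pB_commute (H.W_t_low (i := i) (by omega) (by omega)).symm a).symm
  have hW : W gg i (n - i) = gg i * W gg (i + 1) (n - (i + 1)) := by
    rw [← W_succ']; congr 1; omega
  have h1 : gg i * P R gg tt n i a =
      pB R (tt (i + 1)) a * (gg i * gg i) * W gg (i + 1) (n - (i + 1)) := by
    rw [P, hW, ← mul_assoc, H.g_p1 i (by omega)]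
    simp only [mul_assoc]
  have h2 : P R gg tt n i a * pB R (tt i) a =
      pB R (tt (i + 1)) a * eB R d (tt i) (tt (i + 1)) * gg i * W gg (i + 1) (n - (i + 1)) := by
    have hcomm : Commute (tt i) (tt (i + 1)) := H.tt i (i + 1) (by omega) (by omega)
    have h3 : pB R (tt (i + 1)) a * eB R d (tt i) (tt (i + 1)) =
        eB R d (tt i) (tt (i + 1)) * pB R (tt (i + 1)) a := by
      rw [eB, smul_mul_assoc, mul_smul_comm, Finset.mul_sum, Finset.sum_mul]
      congr 1
      refine Finset.sum_congr rfl fun s _ => ?_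
      refine Commute.eq (Commute.mul_right ?_ ?_)
      · exact (pB_commute (hcomm.pow_left _) a).symm
      · exact (pB_commute ((Commute.refl _).pow_left _) a).symm
    rw [h3, eB_mul_pB_right (H.td _ (by omega)), mul_assoc (pB R (tt i) a), ← H.g_p1 i (by omega),
      P, hW]
    simp only [mul_assoc]
    rw [hc.eq]
  rw [h1, h2, H.quad i (by omega), P, mul_add, mul_one, add_mul]
  simp only [mul_smul_comm, smul_mul_assoc, mul_assoc]

end IsRep

/-! ### The action of the next algebra -/

/-- The free module on symbols standing for `p_{j,a} g_j ⋯ g_{n-1}`. -/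
abbrev Mod (d n : ℕ) (B : Type) [Ring B] : Type := (Fin (n + 1) × ZMod d) →₀ B

/-- The basis vectors, with a coefficient. -/
def vec (n : ℕ) (j : ℕ) (a : ZMod d) (c : B) : Mod d n B := Finsupp.single (Fin.ofNat (n + 1) j, a) c

theorem vec_add (j : ℕ) (a : ZMod d) (c c' : B) :
    vec n j a (c + c') = vec n j a c + vec n j a c' := Finsupp.single_add _ _ _

theorem vec_smul (j : ℕ) (a : ZMod d) (r : R) (c : B) :
    vec n j a (r • c) = r • vec n j a c := (Finsupp.smul_single _ _ _).symm

theorem Mod.hom_ext {N : Type} [AddCommGroup N] [Module R N] {f f' : Mod d n B →ₗ[R] N}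
    (h : ∀ j ≤ n, ∀ a c, f (vec n j a c) = f' (vec n j a c)) : f = f' := by
  apply Finsupp.lhom_ext
  rintro ⟨j, a⟩ c
  have := h j.1 (by omega) a c
  simpa [vec] using this

/-- The left action of `g_i`. -/
def opG (n : ℕ) (v : R) (gg tt : ℕ → B) (i : ℕ) : Module.End R (Mod d n B) :=
  Finsupp.lsum R fun p =>
    if p.1.1 < i then (Finsupp.lsingle p).comp (LinearMap.mulLeft R (gg (i - 1)))
    else if p.1.1 = i then Finsupp.lsingle (Fin.ofNat (n + 1) (i + 1), p.2) +
      v • (Finsupp.lsingle p).comp (LinearMap.mulLeft R (pB R (tt i) p.2))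
    else if p.1.1 = i + 1 then Finsupp.lsingle (Fin.ofNat (n + 1) i, p.2)
    else (Finsupp.lsingle p).comp (LinearMap.mulLeft R (gg i))

/-- The left action of diagonal operators. -/
def opD (R : Type) [CommRing R] {B : Type} [Ring B] [Algebra R B] {d : ℕ}
    (n : ℕ) (u : ℕ → ZMod d → B) : Module.End R (Mod d n B) :=
  Finsupp.lsum R fun p => (Finsupp.lsingle p).comp (LinearMap.mulLeft R (u p.1.1 p.2))

/-- The diagonal coefficients of `t_i`. -/
def uT (R : Type) [CommRing R] [Algebra ℂ R] {B : Type} [Ring B] [Algebra R B]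
    {d : ℕ} [NeZero d] (tt : ℕ → B) (i j : ℕ) (a : ZMod d) : B :=
  if j = i then chi R a • 1 else if i < j then tt i else tt (i - 1)

theorem opD_vec (u : ℕ → ZMod d → B) (j : ℕ) (hj : j ≤ n) (a : ZMod d) (c : B) :
    opD R n u (vec n j a c) = vec n j a (u j a * c) := by
  simp [opD, vec, Nat.mod_eq_of_lt (show j < n + 1 by omega)]

section
variable {v : R} {gg tt : ℕ → B}

theorem opG_high {i j : ℕ} (h : j < i) (hj : j ≤ n) (a : ZMod d) (c : B) :
    opG n v gg tt i (vec n j a c) = vec n j a (gg (i - 1) * c) := by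
  simp [opG, vec, Nat.mod_eq_of_lt (show j < n + 1 by omega), h]

theorem opG_eq {i : ℕ} (hj : i ≤ n) (a : ZMod d) (c : B) :
    opG n v gg tt i (vec n i a c) =
      vec n (i + 1) a c + v • vec n i a (pB R (tt i) a * c) := by
  simp [opG, vec, Nat.mod_eq_of_lt (show i < n + 1 by omega)]

theorem opG_succ {i : ℕ} (hj : i + 1 ≤ n) (a : ZMod d) (c : B) :
    opG n v gg tt i (vec n (i + 1) a c) = vec n i a c := by
  simp [opG, vec, Nat.mod_eq_of_lt (show i + 1 < n + 1 by omega)]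

theorem opG_low {i j : ℕ} (h : i + 1 < j) (hj : j ≤ n) (a : ZMod d) (c : B) :
    opG n v gg tt i (vec n j a c) = vec n j a (gg i * c) := by
  simp [opG, vec, Nat.mod_eq_of_lt (show j < n + 1 by omega), show ¬ j < i by omega,
    show ¬ j = i by omega, show ¬ j = i + 1 by omega]

theorem opD_one : opD R n (fun (_ : ℕ) (_ : ZMod d) => (1 : B)) = 1 :=
  Mod.hom_ext fun j hj a c => by simp [opD_vec _ j hj]

theorem opD_mul (u u' : ℕ → ZMod d → B) :
    opD R n u * opD R n u' = opD R n (fun j a => u j a * u' j a) :=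
  Mod.hom_ext fun j hj a c => by
    rw [Module.End.mul_apply, opD_vec _ j hj, opD_vec _ j hj, opD_vec _ j hj, mul_assoc]

theorem opD_pow (u : ℕ → ZMod d → B) (s : ℕ) :
    opD R n u ^ s = opD R n (fun j a => u j a ^ s) := by
  induction s with
  | zero => simpa using opD_one.symm
  | succ s ih => simp only [pow_succ, ih, opD_mul]

theorem eB_opD (u u' : ℕ → ZMod d → B) :
    eB R d (opD R n u) (opD R n u') = opD R n (fun j a => eB R d (u j a) (u' j a)) :=
  Mod.hom_ext fun j hj a c => by
    rw [opD_vec _ j hj, eB, eB, LinearMap.smul_apply, LinearMap.sum_apply]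
    have : ∀ s : ZMod d, (opD R n u ^ s.val * opD R n u' ^ (-s).val) (vec n j a c) =
        vec n j a (u j a ^ s.val * u' j a ^ (-s).val * c) := fun s => by
      rw [opD_pow, opD_pow, opD_mul, opD_vec _ j hj]
    simp only [this]
    rw [smul_mul_assoc, vec_smul, Finset.sum_mul]
    congr 1
    exact (Finsupp.single_finsetSum _ _ _).symm

theorem eB_chi_left {y : B} (a : ZMod d) : eB R d (chi R a • 1) y = pB R y a := by
  rw [eB, pB]
  congr 1
  refine Fintype.sum_equiv (Equiv.neg _) _ _ fun s => ?_
  simp only [Equiv.neg_apply, smul_pow, one_pow, smul_mul_assoc, one_mul, chi_nsmul,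
    ZMod.natCast_zmod_val, neg_mul, neg_neg]

theorem eB_chi_right {x : B} (a : ZMod d) : eB R d x (chi R a • 1) = pB R x a := by
  rw [eB, pB]
  congr 1
  refine Finset.sum_congr rfl fun s _ => ?_
  simp only [smul_pow, one_pow, mul_smul_comm, mul_one, chi_nsmul,
    ZMod.natCast_zmod_val, neg_mul]

theorem chi_pow_d (a : ZMod d) : chi R a ^ d = 1 := by
  rw [chi_nsmul]; simp [chi_zero]

theorem IsRep.mod (H : IsRep d n v gg tt) :
    IsRep d (n + 1) v (opG (d := d) n v gg tt) (fun i => opD R n (uT (d := d) R tt i)) where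
  braid i h := Mod.hom_ext fun j hj a c => by
    simp only [Module.End.mul_apply]
    rcases lt_trichotomy j i with h1 | h1 | h1
    · simp only [opG_high h1 hj, opG_high (show j < i + 1 by omega) hj, ← mul_assoc]
      have := H.braid (i - 1) (by omega)
      rw [show i - 1 + 1 = i by omega] at this
      simp only [Nat.add_sub_cancel, this]
    · subst h1
      simp only [opG_eq hj, opG_high (show j < j + 1 by omega) hj, opG_eq (show j + 1 ≤ n by omega),
        opG_low (show j + 1 < j + 1 + 1 by omega) (show j + 1 + 1 ≤ n by omega),
        opG_succ (show j + 1 ≤ n by omega), map_add, map_smul, Nat.add_sub_cancel]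
      have e1 := H.g_p1 j (by omega) a
      have e2 : gg j * (pB R (tt j) a * (gg j * c)) =
          pB R (tt (j + 1)) a * c +
            v • (pB R (tt j) a * (gg j * (pB R (tt j) a * c))) := by
        rw [← mul_assoc, e1, mul_assoc, ← mul_assoc (gg j), H.quad j (by omega), add_mul, mul_add,
          one_mul, smul_mul_assoc, mul_smul_comm]
        congr 2
        have hcomm : Commute (tt j) (tt (j + 1)) := H.tt j (j + 1) (by omega) (by omega)
        have h3 : pB R (tt (j + 1)) a * eB R d (tt j) (tt (j + 1)) =
            eB R d (tt j) (tt (j + 1)) * pB R (tt (j + 1)) a := by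
          rw [eB, smul_mul_assoc, mul_smul_comm, Finset.mul_sum, Finset.sum_mul]
          congr 1
          refine Finset.sum_congr rfl fun s _ => ?_
          refine Commute.eq (Commute.mul_right ?_ ?_)
          · exact (pB_commute (hcomm.pow_left _) a).symm
          · exact (pB_commute ((Commute.refl _).pow_left _) a).symm
        rw [← mul_assoc, ← mul_assoc, h3, eB_mul_pB_right (H.td _ (by omega)), mul_assoc _ _ (gg j),
          ← e1]
        simp only [mul_assoc]
      have e3 : gg j * (pB R (tt j) a * c) = pB R (tt (j + 1)) a * (gg j * c) := by
        rw [← mul_assoc, e1, mul_assoc]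
      rw [e2, vec_add, vec_smul, e3]
      simp only [smul_add]
      abel
    · by_cases h2 : j = i + 1
      · subst h2
        simp only [opG_eq hj, opG_eq (show i ≤ n by omega), opG_succ hj,
          opG_high (show i < i + 1 by omega) (show i ≤ n by omega), map_add, map_smul,
          opG_low (show i + 1 < i + 1 + 1 by omega) (show i + 1 + 1 ≤ n by omega),
          opG_succ (show i + 1 + 1 ≤ n by omega), Nat.add_sub_cancel]
        rw [← mul_assoc, ← mul_assoc, H.g_p0 i (by omega)]
      · by_cases h3 : j = i + 1 + 1
        · subst h3
          simp only [opG_low (show i + 1 < i + 1 + 1 by omega) hj, opG_succ hj,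
            opG_succ (show i + 1 ≤ n by omega),
            opG_high (show i < i + 1 by omega) (show i ≤ n by omega), Nat.add_sub_cancel]
        · simp only [opG_low (show i + 1 < j by omega) hj,
            opG_low (show i + 1 + 1 < j by omega) hj, ← mul_assoc]
          rw [H.braid i (by omega)]
  far i k hik hk := Mod.hom_ext fun j hj a c => by
    simp only [Module.End.mul_apply]
    have hlow : ∀ x, i + 1 < x → x ≤ n → ∀ a c,
      opG (d := d) n v gg tt i (vec n x a c) = vec n x a (gg i * c) := fun x hx hx' a c =>
        opG_low hx hx' a c
    have hhigh : ∀ x, x < k → ∀ a c,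
      opG (d := d) n v gg tt k (vec n x a c) = vec n x a (gg (k - 1) * c) := fun x hx a c =>
        opG_high hx (by omega) a c
    rcases lt_trichotomy j i with h1 | h1 | h1
    · simp only [opG_high h1 hj, hhigh j (by omega), ← mul_assoc]
      rw [H.far (i - 1) (k - 1) (by omega) (by omega)]
    · subst h1
      rw [hhigh j (by omega), opG_eq hj, opG_eq hj, map_add, map_smul, hhigh (j + 1) hik,
        hhigh j (by omega), ← mul_assoc, ← mul_assoc, H.g_p (k - 1) j (by omega) (by omega)
          (by omega) (by omega)]
    · by_cases h2 : j = i + 1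
      · subst h2
        rw [hhigh _ (by omega), opG_succ hj, opG_succ hj, hhigh _ (by omega)]
      have h3 : i + 1 < j := by omega
      rw [hlow j h3 hj]
      rcases lt_trichotomy j k with h4 | h4 | h4
      · rw [hhigh j h4, hhigh j h4, hlow j h3 hj, ← mul_assoc, ← mul_assoc,
          H.far i (k - 1) (by omega) (by omega)]
      · subst h4
        rw [opG_eq hj, opG_eq hj, map_add, map_smul, hlow _ (by omega) (by omega), hlow _ h3 hj,
          ← mul_assoc, ← mul_assoc, H.g_p i j (by omega) (by omega) (by omega) (by omega)]
      · by_cases h5 : j = k + 1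
        · subst h5
          rw [opG_succ hj, opG_succ hj, hlow k hik (by omega)]
        · rw [opG_low (show k + 1 < j by omega) hj, opG_low (show k + 1 < j by omega) hj,
            hlow j h3 hj, ← mul_assoc, ← mul_assoc, H.far i k hik (by omega)]
  tt i k hi hk := Mod.hom_ext fun j hj a c => by
    rw [opD_mul, opD_mul, opD_vec _ j hj, opD_vec _ j hj]
    congr 2
    simp only [uT]
    split_ifs <;> first
      | exact H.tt _ _ (by omega) (by omega)
      | simp
  tg0 i h := Mod.hom_ext fun j hj a c => by
    simp only [Module.End.mul_apply, opD_vec _ j hj]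
    rcases lt_trichotomy j i with h1 | h1 | h1
    · simp only [opG_high h1 hj, opD_vec _ j hj, uT, if_neg (show ¬ j = i by omega),
        if_neg (show ¬ i < j by omega), if_neg (show ¬ j = i + 1 by omega),
        if_neg (show ¬ i + 1 < j by omega), ← mul_assoc]
      have := H.tg0 (i - 1) (by omega)
      rw [show i - 1 + 1 = i by omega] at this
      rw [this]; rfl
    · subst h1
      simp only [opG_eq hj, map_add, map_smul, opD_vec _ j hj, opD_vec _ (j + 1) (by omega : j + 1 ≤ n),
        uT, if_true, if_neg (show ¬ j + 1 = j by omega), if_pos (show j < j + 1 by omega),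
        if_neg (show ¬ j = j + 1 by omega), if_neg (show ¬ j + 1 < j by omega)]
      rw [smul_mul_assoc, one_mul, Nat.add_sub_cancel, ← mul_assoc (pB R (tt j) a),
        ← H.t_p j j (by omega) (by omega), mul_pB (H.td _ (by omega)), smul_mul_assoc]
    · by_cases h2 : j = i + 1
      · subst h2
        simp only [opG_succ hj, opD_vec _ i (by omega : i ≤ n), uT, if_true]
      · simp only [opG_low (show i + 1 < j by omega) hj, opD_vec _ j hj, uT,
          if_neg (show ¬ j = i by omega), if_pos (show i < j by omega), if_neg h2,
          if_pos (show i + 1 < j by omega), ← mul_assoc]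
        rw [H.tg0 i (by omega)]
  tg1 i h := Mod.hom_ext fun j hj a c => by
    simp only [Module.End.mul_apply, opD_vec _ j hj]
    rcases lt_trichotomy j i with h1 | h1 | h1
    · simp only [opG_high h1 hj, opD_vec _ j hj, uT, if_neg (show ¬ j = i by omega),
        if_neg (show ¬ i < j by omega), if_neg (show ¬ j = i + 1 by omega),
        if_neg (show ¬ i + 1 < j by omega), ← mul_assoc]
      have := H.tg1 (i - 1) (by omega)
      rw [show i - 1 + 1 = i by omega] at this
      rw [← this]; rfl
    · subst h1
      simp only [opG_eq hj, map_add, map_smul, opD_vec _ j hj, opD_vec _ (j + 1) (by omega : j + 1 ≤ n),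
        uT, if_true, if_neg (show ¬ j = j + 1 by omega), if_neg (show ¬ j + 1 < j by omega)]
      rw [smul_mul_assoc, one_mul, Nat.add_sub_cancel, ← mul_assoc (tt j), 
        mul_pB (H.td _ (by omega)), mul_smul_comm, smul_mul_assoc]
    · by_cases h2 : j = i + 1
      · subst h2
        simp only [opG_succ hj, opD_vec _ i (by omega : i ≤ n), uT,
          if_neg (show ¬ i + 1 = i by omega), if_pos (show i < i + 1 by omega),
          if_neg (show ¬ i = i + 1 by omega), if_neg (show ¬ i + 1 < i by omega),
          Nat.add_sub_cancel]
      · simp only [opG_low (show i + 1 < j by omega) hj, opD_vec _ j hj, uT,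
          if_neg (show ¬ j = i by omega), if_pos (show i < j by omega), if_neg h2,
          if_pos (show i + 1 < j by omega), ← mul_assoc]
        rw [H.tg1 i (by omega)]
  tg i k h hk h1 h2 := Mod.hom_ext fun j hj a c => by
    simp only [Module.End.mul_apply, opD_vec _ j hj]
    rcases lt_trichotomy j i with h3 | h3 | h3
    · simp only [opG_high h3 hj, opD_vec _ j hj, ← mul_assoc]
      congr 2
      simp only [uT]
      split_ifs
      · simp
      · exact H.tg _ _ (by omega) (by omega) (by omega) (by omega)
      · exact H.tg _ _ (by omega) (by omega) (by omega) (by omega)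
    · subst h3
      have hu : uT R tt k (j + 1) a = uT R tt k j a := by
        simp only [uT]
        split_ifs <;> first | omega | rfl
      simp only [opG_eq hj, map_add, map_smul, opD_vec _ j hj,
        opD_vec _ (j + 1) (by omega : j + 1 ≤ n), hu, ← mul_assoc]
      have : uT R tt k j a * pB R (tt j) a = pB R (tt j) a * uT R tt k j a := by
        simp only [uT]
        split_ifs
        · simp
        · exact H.t_p _ _ (by omega) (by omega) _
        · exact H.t_p _ _ (by omega) (by omega) _
      rw [this]
    · by_cases h4 : j = i + 1
      · subst h4
        have hu : uT R tt k (i + 1) a = uT R tt k i a := by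
          simp only [uT]
          split_ifs <;> first | omega | rfl
        simp only [opG_succ hj, opD_vec _ i (by omega : i ≤ n), hu]
      · simp only [opG_low (show i + 1 < j by omega) hj, opD_vec _ j hj, ← mul_assoc]
        congr 2
        simp only [uT]
        split_ifs
        · simp
        · exact H.tg _ _ (by omega) (by omega) (by omega) (by omega)
        · exact H.tg _ _ (by omega) (by omega) (by omega) (by omega)
  td i hi := Mod.hom_ext fun j hj a c => by
    rw [opD_pow, opD_vec _ j hj]
    have : uT R tt i j a ^ d = 1 := by
      simp only [uT]
      split_ifs
      · rw [smul_pow, chi_pow_d, one_pow, one_smul]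
      · exact H.td _ (by omega)
      · exact H.td _ (by omega)
    rw [this, one_mul, Module.End.one_apply]
  quad i h := Mod.hom_ext fun j hj a c => by
    rw [eB_opD]
    simp only [Module.End.mul_apply, LinearMap.add_apply, LinearMap.smul_apply,
      Module.End.one_apply]
    rcases lt_trichotomy j i with h1 | h1 | h1
    · simp only [opG_high h1 hj, opD_vec _ j hj, ← mul_assoc]
      have := H.quad (i - 1) (by omega)
      rw [show i - 1 + 1 = i by omega] at this
      rw [this, add_mul, one_mul, vec_add, smul_mul_assoc, vec_smul]
      congr 3
      simp only [uT, if_neg (show ¬ j = i by omega), if_neg (show ¬ i < j by omega),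
        if_neg (show ¬ j = i + 1 by omega), if_neg (show ¬ i + 1 < j by omega), Nat.add_sub_cancel]
    · subst h1
      have u1 : eB R d (uT R tt j j a) (uT R tt (j + 1) j a) = pB R (tt j) a := by
        simp only [uT, if_true, if_neg (show ¬ j = j + 1 by omega),
          if_neg (show ¬ j + 1 < j by omega), Nat.add_sub_cancel, eB_chi_left]
      have u2 : eB R d (uT R tt j (j + 1) a) (uT R tt (j + 1) (j + 1) a) = pB R (tt j) a := by
        simp only [uT, if_true, if_neg (show ¬ j + 1 = j by omega),
          if_pos (show j < j + 1 by omega), eB_chi_right]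
      simp only [opG_eq hj, map_add, map_smul, opG_succ (show j + 1 ≤ n by omega),
        opD_vec _ j hj, opD_vec _ (j + 1) (by omega : j + 1 ≤ n), u1, u2]
    · by_cases h2 : j = i + 1
      · subst h2
        have u1 : eB R d (uT R tt i i a) (uT R tt (i + 1) i a) = pB R (tt i) a := by
          simp only [uT, if_true, if_neg (show ¬ i = i + 1 by omega),
            if_neg (show ¬ i + 1 < i by omega), Nat.add_sub_cancel, eB_chi_left]
        simp only [opG_succ hj, opG_eq (show i ≤ n by omega), opD_vec _ i (by omega : i ≤ n), u1]
      · simp only [opG_low (show i + 1 < j by omega) hj, opD_vec _ j hj, ← mul_assoc]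
        rw [H.quad i (by omega), add_mul, one_mul, vec_add, smul_mul_assoc, vec_smul]
        simp only [uT, if_neg (show ¬ j = i by omega), if_pos (show i < j by omega), if_neg h2,
          if_pos (show i + 1 < j by omega)]

end

/-! ### The inclusions `Y_{d,n} → Y_{d,n+1}` -/

theorem IsRep.mono {v : R} {gg tt : ℕ → B} (H : IsRep d (n + 1) v gg tt) : IsRep d n v gg tt where
  braid i h := H.braid i (by omega)
  far i j h h' := H.far i j h (by omega)
  tt i j h h' := H.tt i j (by omega) (by omega)
  tg0 i h := H.tg0 i (by omega)
  tg1 i h := H.tg1 i (by omega)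
  tg i j h h' h1 h2 := H.tg i j (by omega) (by omega) h1 h2
  td j h := H.td j (by omega)
  quad i h := H.quad i (by omega)

/-- The natural homomorphism `Y_{d,n}(q) → Y_{d,n+1}(q)`, sending `g_i` to `g_i` and `t_j` to
`t_j`. -/
def incl (d n : ℕ) [NeZero d] (q : Rˣ) : Y R d n q →ₐ[R] Y R d (n + 1) q :=
  Y.lift (isRep_Y (n := n + 1)).mono

theorem incl_gT (i : ℕ) (h : i + 1 < n) : incl d n q (gT d n q i) = gT d (n + 1) q i :=
  Y.lift_gT _ _ h

theorem incl_tT (i : ℕ) (h : i < n) : incl d n q (tT d n q i) = tT d (n + 1) q i :=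
  Y.lift_tT _ _ h

/-! ### The conditional expectation -/

/-- The action of `Y_{d,n+1}(q)` on the free module. -/
def act (d n : ℕ) [NeZero d] (q : Rˣ) : Y R d (n + 1) q →ₐ[R] Module.End R (Mod d n (Y R d n q)) :=
  Y.lift (isRep_Y (n := n)).mod

/-- The cyclic vector. -/
def vac (d n : ℕ) [NeZero d] (B : Type) [Ring B] : Mod d n B := ∑ a : ZMod d, vec n n a 1

/-- The evaluation of the free module in `Y_{d,n+1}(q)`. -/
def ev (d n : ℕ) [NeZero d] (q : Rˣ) : Mod d n (Y R d n q) →ₗ[R] Y R d (n + 1) q :=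
  Finsupp.lsum R fun p => (LinearMap.mulLeft R
    (P R (gT d (n + 1) q) (tT d (n + 1) q) n p.1.1 p.2)).comp (incl d n q).toLinearMap

theorem ev_vec (j : ℕ) (hj : j ≤ n) (a : ZMod d) (c : Y R d n q) :
    ev d n q (vec n j a c) = P R (gT d (n + 1) q) (tT d (n + 1) q) n j a * incl d n q c := by
  simp [ev, vec, Nat.mod_eq_of_lt (show j < n + 1 by omega)]

theorem act_gT (i : ℕ) (h : i < n) : act d n q (gT d (n + 1) q i) =
    opG n ((q : R) - ((q⁻¹ : Rˣ) : R)) (gT d n q) (tT d n q) i :=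
  Y.lift_gT _ _ (by omega)

theorem act_tT (i : ℕ) (h : i ≤ n) : act d n q (tT d (n + 1) q i) =
    opD R n (uT R (tT d n q) i) :=
  Y.lift_tT _ _ (by omega)

theorem ev_act (y : Y R d (n + 1) q) : ∀ m, ev d n q (act d n q y m) = y * ev d n q m := by
  have H := isRep_Y (R := R) (d := d) (n := n + 1) (q := q)
  let S : Subalgebra R (Y R d (n + 1) q) :=
    { carrier := {y | ∀ m, ev d n q (act d n q y m) = y * ev d n q m}
      mul_mem' := fun {x y} hx hy m => by
        rw [map_mul, Module.End.mul_apply, hx, hy, mul_assoc]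
      add_mem' := fun {x y} hx hy m => by
        rw [map_add, LinearMap.add_apply, map_add, hx, hy, add_mul]
      algebraMap_mem' := fun r m => by
        rw [AlgHom.commutes, Module.algebraMap_end_apply, map_smul, Algebra.smul_def] }
  refine Y.mem_of_gen S (fun i hi => ?_) (fun i hi => ?_) y
  · suffices h : (ev d n q).comp (act d n q (gT d (n + 1) q i)) =
        (LinearMap.mulLeft R (gT d (n + 1) q i)).comp (ev d n q) from
      fun m => LinearMap.congr_fun h m
    refine Mod.hom_ext fun j hj a c => ?_
    rw [act_gT i (by omega)]
    simp only [LinearMap.comp_apply, LinearMap.mulLeft_apply]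
    rcases lt_trichotomy j i with h1 | h1 | h1
    · rw [opG_high h1 hj, ev_vec j hj, ev_vec j hj, map_mul, incl_gT _ (by omega), ← mul_assoc,
        ← mul_assoc, H.g_P_high i j h1 (by omega)]
    · subst h1
      have hp : incl d n q (pB R (tT d n q j) a) = pB R (tT d (n + 1) q j) a := by
        simp [pB, incl_tT j (show j < n by omega)]
      rw [opG_eq hj, map_add, map_smul, ev_vec j hj, ev_vec (j + 1) (by omega), ev_vec j hj,
        map_mul, hp, ← mul_assoc, ← mul_assoc, H.g_P_eq j (by omega), add_mul, smul_mul_assoc]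
    · by_cases h2 : j = i + 1
      · subst h2
        rw [opG_succ hj, ev_vec _ hj, ev_vec i (by omega), ← mul_assoc, H.g_P_succ i (by omega)]
      · rw [opG_low (by omega) hj, ev_vec j hj, ev_vec j hj, map_mul, incl_gT _ (by omega),
          ← mul_assoc, ← mul_assoc, H.g_P_low i j (by omega) hj]
  · suffices h : (ev d n q).comp (act d n q (tT d (n + 1) q i)) =
        (LinearMap.mulLeft R (tT d (n + 1) q i)).comp (ev d n q) from
      fun m => LinearMap.congr_fun h m
    refine Mod.hom_ext fun j hj a c => ?_
    rw [act_tT i (by omega)]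
    simp only [LinearMap.comp_apply, LinearMap.mulLeft_apply, opD_vec _ j hj, uT]
    rcases lt_trichotomy j i with h1 | h1 | h1
    · rw [if_neg (by omega), if_neg (by omega), ev_vec j hj, ev_vec j hj, map_mul,
        incl_tT _ (by omega), ← mul_assoc, ← mul_assoc, H.t_P_high i j h1 (by omega)]
    · subst h1
      rw [if_pos rfl, smul_mul_assoc, one_mul, vec_smul, map_smul, ev_vec j hj, ← mul_assoc,
        H.t_P_eq j hj, smul_mul_assoc]
    · rw [if_neg (by omega), if_pos h1, ev_vec j hj, ev_vec j hj, map_mul,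
        incl_tT _ (by omega), ← mul_assoc, ← mul_assoc, H.t_P_low i j h1 hj]

theorem ev_vac : ev d n q (vac d n (Y R d n q)) = (1 : Y R d (n + 1) q) := by
  have : ∀ a : ZMod d, ev d n q (vec n n a 1) = pB R (tT d (n + 1) q n) a := fun a => by
    rw [ev_vec n le_rfl, P, Nat.sub_self, W, map_one, mul_one, mul_one]
  rw [vac, map_sum, Finset.sum_congr rfl fun a _ => this a, sum_pB]

/-- The inductive spanning set of `Y_{d,n+1}(q)`. -/
theorem span_induction {C : Y R d (n + 1) q → Prop} (hadd : ∀ x y, C x → C y → C (x + y))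
    (h0 : C 0)
    (ht : ∀ (a : ZMod d) (c : Y R d n q), C (pB R (tT d (n + 1) q n) a * incl d n q c))
    (hg : 1 ≤ n → ∀ b c : Y R d n q, C (incl d n q b * gT d (n + 1) q (n - 1) * incl d n q c))
    (y : Y R d (n + 1) q) : C y := by
  have key : ∀ m, C (ev d n q m) := fun m => by
    induction m using Finsupp.induction_linear with
    | zero => rw [map_zero]; exact h0
    | add x y hx hy => rw [map_add]; exact hadd _ _ hx hy
    | single p c =>
      obtain ⟨j, a⟩ := p
      have : (Finsupp.single (j, a) c : Mod d n (Y R d n q)) = vec n j.1 a c := by simp [vec]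
      rw [this, ev_vec _ (by omega)]
      rcases Nat.lt_or_ge j.1 n with hj | hj
      · obtain ⟨k, rfl⟩ : ∃ k, n = k + 1 := ⟨n - 1, by omega⟩
        have h2 := hg (by omega) (P R (gT d (k + 1) q) (tT d (k + 1) q) k j.1 a) c
        have hW : ∀ l, j.1 + l ≤ k → incl d (k + 1) q (W (gT d (k + 1) q) j.1 l) =
            W (gT d (k + 1 + 1) q) j.1 l := fun l => by
          induction l with
          | zero => intro _; simp [W]
          | succ l ih =>
            intro h
            rw [W, W, map_mul, ih (by omega), incl_gT _ (by omega)]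
        have hp : incl d (k + 1) q (pB R (tT d (k + 1) q j.1) a) = pB R (tT d (k + 1 + 1) q j.1) a := by
          simp [pB, incl_tT j.1 (show j.1 < k + 1 by omega)]
        have h3 : incl d (k + 1) q (P R (gT d (k + 1) q) (tT d (k + 1) q) k j.1 a) *
            gT d (k + 1 + 1) q (k + 1 - 1) =
            P R (gT d (k + 1 + 1) q) (tT d (k + 1 + 1) q) (k + 1) j.1 a := by
          rw [P, P, map_mul, hW _ (by omega), show k + 1 - j.1 = (k - j.1) + 1 by omega, W, hp,
            mul_assoc, show j.1 + (k - j.1) = k + 1 - 1 by omega]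
        rw [h3] at h2
        exact h2
      · have : j.1 = n := by omega
        rw [this, P, Nat.sub_self, W, mul_one]
        exact ht a c
  have := ev_act y (vac d n (Y R d n q))
  rw [ev_vac, mul_one] at this
  rw [← this]
  exact key _

section Trace

variable (z : R) (w : ZMod d → R)

/-- The functional that defines the conditional expectation. -/
def eps (d n : ℕ) [NeZero d] (q : Rˣ) (z : R) (w : ZMod d → R) :
    Mod d n (Y R d n q) →ₗ[R] Y R d n q :=
  Finsupp.lsum R fun p => if p.1.1 = n then w p.2 • LinearMap.id else
    z • LinearMap.mulLeft R (P R (gT d n q) (tT d n q) (n - 1) p.1.1 p.2)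

theorem eps_last (a : ZMod d) (c : Y R d n q) : eps d n q z w (vec n n a c) = w a • c := by
  simp [eps, vec]

theorem eps_lt {j : ℕ} (hj : j < n) (a : ZMod d) (c : Y R d n q) : eps d n q z w (vec n j a c) =
    z • (P R (gT d n q) (tT d n q) (n - 1) j a * c) := by
  simp [eps, vec, Nat.mod_eq_of_lt (show j < n + 1 by omega), show ¬ j = n by omega]

theorem eps_g (i : ℕ) (h : i + 1 < n) (m) :
    eps d n q z w (act d n q (gT d (n + 1) q i) m) = gT d n q i * eps d n q z w m := by
  suffices h : (eps d n q z w).comp (act d n q (gT d (n + 1) q i)) =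
      (LinearMap.mulLeft R (gT d n q i)).comp (eps d n q z w) from LinearMap.congr_fun h m
  refine Mod.hom_ext fun j hj a c => ?_
  rw [act_gT i (by omega)]
  simp only [LinearMap.comp_apply, LinearMap.mulLeft_apply]
  obtain ⟨k, rfl⟩ : ∃ k, n = k + 1 := ⟨n - 1, by omega⟩
  have H := isRep_Y (R := R) (d := d) (n := k + 1) (q := q)
  rcases Nat.lt_or_ge j (k + 1) with hj' | hj'
  · rcases lt_trichotomy j i with h1 | h1 | h1
    · rw [opG_high h1 hj, eps_lt _ _ hj', eps_lt _ _ hj', ← mul_assoc, mul_smul_comm,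
        ← mul_assoc (gT d (k + 1) q i), Nat.add_sub_cancel, H.g_P_high i j h1 (by omega)]
    · subst h1
      rw [opG_eq hj, map_add, map_smul, eps_lt _ _ hj', eps_lt _ _ h, eps_lt _ _ hj',
        mul_smul_comm, ← mul_assoc (gT d (k + 1) q j), Nat.add_sub_cancel,
        H.g_P_eq j (by omega), add_mul, smul_add, smul_mul_assoc, smul_comm z, ← mul_assoc]
    · by_cases h2 : j = i + 1
      · subst h2
        rw [opG_succ hj, eps_lt _ _ hj', eps_lt _ _ (by omega), mul_smul_comm, ← mul_assoc,
          Nat.add_sub_cancel, H.g_P_succ i (by omega)]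
      · rw [opG_low (by omega) hj, eps_lt _ _ hj', eps_lt _ _ hj', mul_smul_comm, ← mul_assoc,
          ← mul_assoc, Nat.add_sub_cancel, H.g_P_low i j (by omega) (by omega)]
  · have : j = k + 1 := by omega
    subst this
    rw [opG_low h le_rfl, eps_last, eps_last, mul_smul_comm]

theorem eps_t (i : ℕ) (h : i < n) (m) :
    eps d n q z w (act d n q (tT d (n + 1) q i) m) = tT d n q i * eps d n q z w m := by
  suffices h : (eps d n q z w).comp (act d n q (tT d (n + 1) q i)) =
      (LinearMap.mulLeft R (tT d n q i)).comp (eps d n q z w) from LinearMap.congr_fun h m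
  refine Mod.hom_ext fun j hj a c => ?_
  rw [act_tT i (by omega)]
  simp only [LinearMap.comp_apply, LinearMap.mulLeft_apply, opD_vec _ j hj, uT]
  obtain ⟨k, rfl⟩ : ∃ k, n = k + 1 := ⟨n - 1, by omega⟩
  have H := isRep_Y (R := R) (d := d) (n := k + 1) (q := q)
  rcases Nat.lt_or_ge j (k + 1) with hj' | hj'
  · rw [eps_lt _ _ hj', eps_lt _ _ hj', mul_smul_comm, ← mul_assoc, ← mul_assoc,
      Nat.add_sub_cancel]
    rcases lt_trichotomy j i with h1 | h1 | h1
    · rw [if_neg (by omega), if_neg (by omega), H.t_P_high i j h1 (by omega)]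
    · subst h1
      rw [if_pos rfl, H.t_P_eq j (by omega), mul_smul_comm, mul_one]
    · rw [if_neg (by omega), if_pos h1, H.t_P_low i j h1 (by omega)]
  · have : j = k + 1 := by omega
    subst this
    rw [if_neg (by omega), if_pos h, eps_last, eps_last, mul_smul_comm]

theorem eps_incl (c : Y R d n q) : ∀ m,
    eps d n q z w (act d n q (incl d n q c) m) = c * eps d n q z w m := by
  let S : Subalgebra R (Y R d n q) :=
    { carrier := {c | ∀ m, eps d n q z w (act d n q (incl d n q c) m) = c * eps d n q z w m}
      mul_mem' := fun {x y} hx hy m => by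
        rw [map_mul, map_mul, Module.End.mul_apply, hx, hy, mul_assoc]
      add_mem' := fun {x y} hx hy m => by
        rw [map_add, map_add, LinearMap.add_apply, map_add, hx, hy, add_mul]
      algebraMap_mem' := fun r m => by
        rw [AlgHom.commutes, AlgHom.commutes, Module.algebraMap_end_apply, map_smul,
          Algebra.smul_def] }
  refine Y.mem_of_gen S (fun i hi m => ?_) (fun i hi m => ?_) c
  · rw [incl_gT i hi, eps_g z w i hi]
  · rw [incl_tT i hi, eps_t z w i hi]

/-- Right multiplication on the free module. -/
def rmul (n : ℕ) (b : B) : Mod d n B →ₗ[R] Mod d n B :=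
  Finsupp.mapRange.linearMap (LinearMap.mulRight R b)

theorem rmul_vec (b : B) (j : ℕ) (a : ZMod d) (c : B) :
    rmul (R := R) n b (vec n j a c) = vec n j a (c * b) := by
  simp [rmul, vec]

theorem act_rmul (b : Y R d n q) (y : Y R d (n + 1) q) : ∀ m,
    act d n q y (rmul (R := R) n b m) = rmul (R := R) n b (act d n q y m) := by
  let S : Subalgebra R (Y R d (n + 1) q) :=
    { carrier := {y | ∀ m, act d n q y (rmul (R := R) n b m) =
        rmul (R := R) n b (act d n q y m)}
      mul_mem' := fun {x y} hx hy m => by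
        rw [map_mul, Module.End.mul_apply, Module.End.mul_apply, hy, hx]
      add_mem' := fun {x y} hx hy m => by
        rw [map_add, LinearMap.add_apply, LinearMap.add_apply, map_add, hx, hy]
      algebraMap_mem' := fun r m => by
        rw [AlgHom.commutes, Module.algebraMap_end_apply, Module.algebraMap_end_apply, map_smul] }
  refine Y.mem_of_gen S (fun i hi => ?_) (fun i hi => ?_) y
  · suffices h : (act d n q (gT d (n + 1) q i)).comp (rmul (R := R) n b) =
        (rmul (R := R) n b).comp (act d n q (gT d (n + 1) q i)) from
      fun m => LinearMap.congr_fun h m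
    refine Mod.hom_ext fun j hj a c => ?_
    rw [act_gT i (by omega)]
    simp only [LinearMap.comp_apply, rmul_vec]
    rcases lt_trichotomy j i with h1 | h1 | h1
    · rw [opG_high h1 hj, opG_high h1 hj, rmul_vec, mul_assoc]
    · subst h1
      rw [opG_eq hj, opG_eq hj, map_add, map_smul, rmul_vec, rmul_vec, mul_assoc]
    · by_cases h2 : j = i + 1
      · subst h2
        rw [opG_succ hj, opG_succ hj, rmul_vec]
      · rw [opG_low (by omega) hj, opG_low (by omega) hj, rmul_vec, mul_assoc]
  · suffices h : (act d n q (tT d (n + 1) q i)).comp (rmul (R := R) n b) =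
        (rmul (R := R) n b).comp (act d n q (tT d (n + 1) q i)) from
      fun m => LinearMap.congr_fun h m
    refine Mod.hom_ext fun j hj a c => ?_
    rw [act_tT i (by omega)]
    simp only [LinearMap.comp_apply, rmul_vec, opD_vec _ j hj, mul_assoc]

theorem eps_rmul (b : Y R d n q) (m) :
    eps d n q z w (rmul (R := R) n b m) = eps d n q z w m * b := by
  suffices h : (eps d n q z w).comp (rmul (R := R) n b) =
      (LinearMap.mulRight R b).comp (eps d n q z w) from LinearMap.congr_fun h m
  refine Mod.hom_ext fun j hj a c => ?_
  simp only [LinearMap.comp_apply, rmul_vec, LinearMap.mulRight_apply]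
  rcases Nat.lt_or_ge j n with hj' | hj'
  · rw [eps_lt _ _ hj', eps_lt _ _ hj', smul_mul_assoc, mul_assoc]
  · have : j = n := by omega
    subst this
    rw [eps_last, eps_last, smul_mul_assoc]

theorem act_incl_vac (c : Y R d n q) : act d n q (incl d n q c) (vac d n _) =
    rmul (R := R) n c (vac d n _) := by
  let S : Subalgebra R (Y R d n q) :=
    { carrier := {c | act d n q (incl d n q c) (vac d n _) = rmul (R := R) n c (vac d n _)}
      mul_mem' := fun {x y} hx hy => by
        change _ = _ at hx hy
        change _ = _
        rw [map_mul, map_mul, Module.End.mul_apply, hy, act_rmul, hx]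
        simp [vac, rmul_vec]
      add_mem' := fun {x y} hx hy => by
        change _ = _ at hx hy
        change _ = _
        rw [map_add, map_add, LinearMap.add_apply, hx, hy]
        simp [vac, rmul_vec, vec_add, Finset.sum_add_distrib]
      algebraMap_mem' := fun r => by
        change _ = _
        rw [AlgHom.commutes, AlgHom.commutes, Module.algebraMap_end_apply]
        simp [vac, rmul_vec, Finset.smul_sum, ← vec_smul, Algebra.algebraMap_eq_smul_one] }
  refine Y.mem_of_gen S (fun i hi => ?_) (fun i hi => ?_) c
  · change _ = _
    rw [incl_gT i hi, act_gT i (by omega), vac, map_sum, map_sum]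
    refine Finset.sum_congr rfl fun a _ => ?_
    rw [opG_low hi le_rfl, rmul_vec, mul_one, one_mul]
  · change _ = _
    rw [incl_tT i hi, act_tT i (by omega), vac, map_sum, map_sum]
    refine Finset.sum_congr rfl fun a _ => ?_
    rw [opD_vec _ _ le_rfl, uT, if_neg (by omega), if_pos hi, rmul_vec, mul_one, one_mul]

/-- The conditional expectation `Y_{d,n+1}(q) → Y_{d,n}(q)`. -/
def cexp (d n : ℕ) [NeZero d] (q : Rˣ) (z : R) (w : ZMod d → R) :
    Y R d (n + 1) q →ₗ[R] Y R d n q :=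
  (eps d n q z w).comp ((LinearMap.applyₗ (vac d n (Y R d n q))).comp (act d n q).toLinearMap)

theorem cexp_apply (y : Y R d (n + 1) q) :
    cexp d n q z w y = eps d n q z w (act d n q y (vac d n _)) := rfl

theorem cexp_incl_mul (c : Y R d n q) (y : Y R d (n + 1) q) :
    cexp d n q z w (incl d n q c * y) = c * cexp d n q z w y := by
  rw [cexp_apply, map_mul, Module.End.mul_apply, eps_incl, cexp_apply]

theorem cexp_mul_incl (c : Y R d n q) (y : Y R d (n + 1) q) :
    cexp d n q z w (y * incl d n q c) = cexp d n q z w y * c := by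
  rw [cexp_apply, map_mul, Module.End.mul_apply, act_incl_vac, act_rmul, eps_rmul, cexp_apply]

theorem cexp_one (hw : ∑ a, w a = 1) : cexp d n q z w 1 = 1 := by
  rw [cexp_apply, map_one, Module.End.one_apply, vac, map_sum]
  simp only [eps_last]
  rw [← Finset.sum_smul, hw, one_smul]

theorem cexp_g (hn : 1 ≤ n) : cexp d n q z w (gT d (n + 1) q (n - 1)) = z • 1 := by
  obtain ⟨k, rfl⟩ : ∃ k, n = k + 1 := ⟨n - 1, by omega⟩
  rw [cexp_apply, act_gT _ (by omega), vac, map_sum, map_sum, Nat.add_sub_cancel]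
  have : ∀ a : ZMod d, eps d (k + 1) q z w (opG (k + 1) ((q : R) - ((q⁻¹ : Rˣ) : R))
      (gT d (k + 1) q) (tT d (k + 1) q) k (vec (k + 1) (k + 1) a 1)) =
      z • pB R (tT d (k + 1) q k) a := fun a => by
    rw [opG_succ le_rfl, eps_lt _ _ (by omega), P, Nat.add_sub_cancel, Nat.sub_self, W, mul_one,
      mul_one]
  rw [Finset.sum_congr rfl fun a _ => this a, ← Finset.smul_sum, sum_pB]

theorem cexp_t_pow (s : ℕ) : cexp d n q z w (tT d (n + 1) q n ^ s) =
    (∑ a, chi R ((s : ZMod d) * a) * w a) • 1 := by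
  rw [cexp_apply, map_pow, act_tT _ le_rfl, opD_pow, vac, map_sum, map_sum, Finset.sum_smul]
  refine Finset.sum_congr rfl fun a _ => ?_
  rw [opD_vec _ _ le_rfl, uT, if_pos rfl, mul_one, eps_last, smul_pow, one_pow, chi_nsmul, smul_smul,
    mul_comm]

theorem cexp_p (a : ZMod d) : cexp d n q z w (pB R (tT d (n + 1) q n) a) = w a • 1 := by
  rw [pB, map_smul, map_sum]
  simp only [map_smul, cexp_t_pow, smul_smul, ZMod.natCast_zmod_val]
  rw [← Finset.sum_smul, smul_smul]
  congr 1
  simp only [Finset.mul_sum]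
  rw [Finset.sum_comm]
  have : ∀ b : ZMod d, ∑ s : ZMod d, invd R d * (chi R (-(s * a)) * (chi R (s * b) * w b)) =
      if b = a then w b else 0 := fun b => by
    have h := sum_chi (R := R) (b - a)
    rw [Finset.mul_sum] at h
    have h2 : ∀ s : ZMod d, invd R d * (chi R (-(s * a)) * (chi R (s * b) * w b)) =
        invd R d * chi R (s * (b - a)) * w b := fun s => by
      rw [← mul_assoc (chi R _), ← chi_add, ← mul_assoc]
      congr 3; ring
    rw [Finset.sum_congr rfl fun s _ => h2 s, ← Finset.sum_mul, h]
    by_cases hb : b = a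
    · simp [hb]
    · simp [hb, sub_ne_zero.2 hb]
  rw [Finset.sum_congr rfl fun b _ => this b]
  simp

theorem commute_incl {x : Y R d (n + 1) q} (hg : ∀ i, i + 1 < n → Commute x (gT d (n + 1) q i))
    (ht : ∀ i, i < n → Commute x (tT d (n + 1) q i)) (c : Y R d n q) :
    Commute x (incl d n q c) := by
  let S : Subalgebra R (Y R d n q) :=
    { carrier := {c | Commute x (incl d n q c)}
      mul_mem' := fun {a b} ha hb => by
        change Commute _ _
        rw [map_mul]; exact Commute.mul_right ha hb
      add_mem' := fun {a b} ha hb => by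
        change Commute _ _
        rw [map_add]; exact Commute.add_right ha hb
      algebraMap_mem' := fun r => by
        change Commute _ _
        rw [AlgHom.commutes]; exact (Algebra.commutes r x).symm }
  refine Y.mem_of_gen S (fun i hi => ?_) (fun i hi => ?_) c
  · change Commute _ _
    rw [incl_gT i hi]; exact hg i hi
  · change Commute _ _
    rw [incl_tT i hi]; exact ht i hi

theorem t_commute_incl (c : Y R d n q) : Commute (tT d (n + 1) q n) (incl d n q c) :=
  commute_incl (fun i hi => isRep_Y.tg i n (by omega) (by omega) (by omega) (by omega))
    (fun i hi => isRep_Y.tt n i (by omega) (by omega)) c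

theorem g_commute_incl (c : Y R d n q) :
    Commute (gT d (n + 1 + 1) q n) (incl d (n + 1) q (incl d n q c)) := by
  have H := isRep_Y (R := R) (d := d) (n := n + 1 + 1) (q := q)
  let S : Subalgebra R (Y R d n q) :=
    { carrier := {c | Commute (gT d (n + 1 + 1) q n) (incl d (n + 1) q (incl d n q c))}
      mul_mem' := fun {a b} ha hb => by
        change Commute _ _
        rw [map_mul, map_mul]; exact Commute.mul_right ha hb
      add_mem' := fun {a b} ha hb => by
        change Commute _ _
        rw [map_add, map_add]; exact Commute.add_right ha hb
      algebraMap_mem' := fun r => by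
        change Commute _ _
        rw [AlgHom.commutes, AlgHom.commutes]; exact (Algebra.commutes r _).symm }
  refine Y.mem_of_gen S (fun i hi => ?_) (fun i hi => ?_) c
  · change Commute _ _
    rw [incl_gT i hi, incl_gT i (by omega)]
    exact (H.far i n (by omega) (by omega)).symm
  · change Commute _ _
    rw [incl_tT i hi, incl_tT i (by omega)]
    exact (H.tg n i (by omega) (by omega) (by omega) (by omega)).symm

/-! ### The trace -/

theorem isRep_zero : IsRep (B := R) d 0 ((q : R) - ((q⁻¹ : Rˣ) : R)) (fun _ => 0) (fun _ => 0) where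
  braid i h := by omega
  far i j h h' := by omega
  tt i j h h' := by omega
  tg0 i h := by omega
  tg1 i h := by omega
  tg i j h h' := by omega
  td j h := by omega
  quad i h := by omega

/-- The trace, built from the conditional expectations. -/
def tau (d : ℕ) [NeZero d] (q : Rˣ) (z : R) (w : ZMod d → R) : ∀ n, Y R d n q →ₗ[R] R
  | 0 => (Y.lift (isRep_zero (R := R) (d := d) (q := q))).toLinearMap
  | n + 1 => (tau d q z w n).comp (cexp d n q z w)

theorem tau_succ (y : Y R d (n + 1) q) :
    tau d q z w (n + 1) y = tau d q z w n (cexp d n q z w y) := rfl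

theorem cexp_pg (k : ℕ) (a : ZMod d) :
    cexp d (k + 1) q z w (pB R (tT d (k + 1 + 1) q (k + 1)) a * gT d (k + 1 + 1) q k) =
      z • pB R (tT d (k + 1) q k) a := by
  have H := isRep_Y (R := R) (d := d) (n := k + 1 + 1) (q := q)
  have hp : incl d (k + 1) q (pB R (tT d (k + 1) q k) a) = pB R (tT d (k + 1 + 1) q k) a := by
    simp [pB, incl_tT k (show k < k + 1 by omega)]
  have hg := cexp_g (d := d) (q := q) z w (show 1 ≤ k + 1 by omega)
  rw [Nat.add_sub_cancel] at hg
  rw [← H.g_p1 k (by omega), ← hp, cexp_mul_incl, hg, smul_mul_assoc, one_mul]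

theorem p_incl (k : ℕ) (a : ZMod d) :
    incl d (k + 1) q (pB R (tT d (k + 1) q k) a) = pB R (tT d (k + 1 + 1) q k) a := by
  simp [pB, incl_tT k (show k < k + 1 by omega)]

theorem mul_eB_comm {x y : B} (h : Commute x y) (a : ZMod d) :
    pB R y a * eB R d x y = eB R d x y * pB R y a := by
  rw [eB, smul_mul_assoc, mul_smul_comm, Finset.mul_sum, Finset.sum_mul]
  congr 1
  refine Finset.sum_congr rfl fun s _ => ?_
  refine Commute.eq (Commute.mul_right ?_ ?_)
  · exact (pB_commute (h.pow_left _) a).symm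
  · exact (pB_commute ((Commute.refl _).pow_left _) a).symm

theorem cexp_peg (k : ℕ) (a : ZMod d) :
    cexp d (k + 1) q z w (pB R (tT d (k + 1 + 1) q (k + 1)) a *
      (eB R d (tT d (k + 1 + 1) q k) (tT d (k + 1 + 1) q (k + 1)) * gT d (k + 1 + 1) q k)) =
      z • pB R (tT d (k + 1) q k) a := by
  have H := isRep_Y (R := R) (d := d) (n := k + 1 + 1) (q := q)
  rw [← mul_assoc, mul_eB_comm (H.tt _ _ (by omega) (by omega)),
    eB_mul_pB_right (H.td _ (by omega)), mul_assoc, ← p_incl, cexp_incl_mul, cexp_pg,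
    mul_smul_comm, pB_idem ((isRep_Y (n := k + 1)).td _ (by omega))]

/-- The sandwich map `b ↦ E(g b g)`. -/
def sand (d k : ℕ) [NeZero d] (q : Rˣ) (z : R) (w : ZMod d → R) (b : Y R d (k + 1) q) :
    Y R d (k + 1) q :=
  cexp d (k + 1) q z w (gT d (k + 1 + 1) q k * incl d (k + 1) q b * gT d (k + 1 + 1) q k)

theorem sand_add (k : ℕ) (b c : Y R d (k + 1) q) :
    sand d k q z w (b + c) = sand d k q z w b + sand d k q z w c := by
  simp [sand, mul_add, add_mul]

theorem sand_zero (k : ℕ) : sand d k q z w 0 = 0 := by simp [sand]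

theorem sand_bimod (k : ℕ) (x y : Y R d k q) (b : Y R d (k + 1) q) :
    sand d k q z w (incl d k q x * b * incl d k q y) =
      incl d k q x * sand d k q z w b * incl d k q y := by
  have h1 := (g_commute_incl x).eq
  have h2 := (g_commute_incl y).eq
  have : gT d (k + 1 + 1) q k * incl d (k + 1) q (incl d k q x * b * incl d k q y) *
      gT d (k + 1 + 1) q k = incl d (k + 1) q (incl d k q x) *
      (gT d (k + 1 + 1) q k * incl d (k + 1) q b * gT d (k + 1 + 1) q k *
        incl d (k + 1) q (incl d k q y)) := by
    simp only [map_mul, mul_assoc, h2]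
    simp only [← mul_assoc, h1]
  rw [sand, this, cexp_incl_mul, cexp_mul_incl, sand, ← mul_assoc]

theorem sand_left (k : ℕ) (x : Y R d k q) (b : Y R d (k + 1) q) :
    sand d k q z w (incl d k q x * b) = incl d k q x * sand d k q z w b := by
  simpa using sand_bimod z w k x 1 b

theorem sand_right (k : ℕ) (y : Y R d k q) (b : Y R d (k + 1) q) :
    sand d k q z w (b * incl d k q y) = sand d k q z w b * incl d k q y := by
  simpa using sand_bimod z w k 1 y b

theorem sand_p (k : ℕ) (a : ZMod d) :
    sand d k q z w (pB R (tT d (k + 1) q k) a) =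
      w a • 1 + (((q : R) - ((q⁻¹ : Rˣ) : R)) * z) • pB R (tT d (k + 1) q k) a := by
  have H := isRep_Y (R := R) (d := d) (n := k + 1 + 1) (q := q)
  rw [sand, p_incl, H.g_p1 k (by omega), mul_assoc, H.quad k (by omega), mul_add, mul_one, map_add,
    mul_smul_comm, map_smul, cexp_peg, cexp_p, smul_smul]

theorem sand_g (k : ℕ) : sand d (k + 1) q z w (gT d (k + 1 + 1) q k) =
    z • (gT d (k + 1 + 1) q k * gT d (k + 1 + 1) q k) := by
  have H := isRep_Y (R := R) (d := d) (n := k + 1 + 1 + 1) (q := q)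
  have hg := cexp_g (d := d) (q := q) z w (show 1 ≤ k + 1 + 1 by omega)
  rw [Nat.add_sub_cancel] at hg
  rw [sand, incl_gT k (by omega), ← H.braid k (by omega), ← incl_gT k (show k + 1 < k + 1 + 1 by omega),
    cexp_mul_incl, cexp_incl_mul, hg, mul_smul_comm, mul_one, smul_mul_assoc]

/-- The trace condition in a fixed degree. -/
def Tracial (d : ℕ) [NeZero d] (q : Rˣ) (z : R) (w : ZMod d → R) (n : ℕ) : Prop :=
  ∀ x y : Y R d n q, tau d q z w n (x * y) = tau d q z w n (y * x)

theorem sand_symm_p (k : ℕ) (a : ZMod d)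
    (c : Y R d (k + 1) q) :
    tau d q z w (k + 1) (sand d k q z w (pB R (tT d (k + 1) q k) a) * c) =
      tau d q z w (k + 1) (pB R (tT d (k + 1) q k) a * sand d k q z w c) := by
  have H := isRep_Y (R := R) (d := d) (n := k + 1) (q := q)
  induction c using span_induction with
  | hadd x y hx hy => rw [mul_add, map_add, hx, hy, sand_add, mul_add, map_add]
  | h0 => rw [sand_zero, mul_zero, mul_zero]
  | ht b c =>
    have hA : ∀ b : ZMod d, tau d q z w (k + 1) (pB R (tT d (k + 1) q k) b * incl d k q c) =
        w b * tau d q z w k c := fun b => by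
      rw [tau_succ, cexp_mul_incl, cexp_p, smul_mul_assoc, one_mul, map_smul, smul_eq_mul]
    rw [sand_right, sand_p z w, sand_p z w, add_mul, add_mul, mul_add, map_add, map_add,
      smul_mul_assoc, smul_mul_assoc, smul_mul_assoc, smul_mul_assoc, mul_smul_comm, mul_smul_comm,
      one_mul, one_mul]
    simp only [map_smul, hA, smul_eq_mul]
    ring
  | hg hk c1 c2 =>
    obtain ⟨l, rfl⟩ : ∃ l, k = l + 1 := ⟨k - 1, by omega⟩
    rw [Nat.add_sub_cancel]
    have hc1 : pB R (tT d (l + 1 + 1) q (l + 1)) a * incl d (l + 1) q c1 =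
        incl d (l + 1) q c1 * pB R (tT d (l + 1 + 1) q (l + 1)) a :=
      (pB_commute (t_commute_incl c1).symm a).eq.symm
    have hg := cexp_g (d := d) (q := q) z w (show 1 ≤ l + 1 by omega)
    rw [Nat.add_sub_cancel] at hg
    have f1 : cexp d (l + 1) q z w (incl d (l + 1) q c1 * gT d (l + 1 + 1) q l *
        incl d (l + 1) q c2) = z • (c1 * c2) := by
      rw [cexp_mul_incl, cexp_incl_mul, hg, mul_smul_comm, mul_one, smul_mul_assoc]
    have f2 : cexp d (l + 1) q z w (pB R (tT d (l + 1 + 1) q (l + 1)) a *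
        (incl d (l + 1) q c1 * gT d (l + 1 + 1) q l * incl d (l + 1) q c2)) =
        z • (c1 * pB R (tT d (l + 1) q l) a * c2) := by
      rw [← mul_assoc, ← mul_assoc, hc1, cexp_mul_incl, mul_assoc (incl _ _ _ _), cexp_incl_mul,
        cexp_pg, mul_smul_comm, smul_mul_assoc]
    have f3 : cexp d (l + 1) q z w (pB R (tT d (l + 1 + 1) q (l + 1)) a *
        (incl d (l + 1) q c1 * incl d (l + 1) q c2)) = w a • (c1 * c2) := by
      rw [← map_mul, cexp_mul_incl, cexp_p, smul_mul_assoc, one_mul]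
    have f4 : cexp d (l + 1) q z w (pB R (tT d (l + 1 + 1) q (l + 1)) a *
        (incl d (l + 1) q c1 * (eB R d (tT d (l + 1 + 1) q l) (tT d (l + 1 + 1) q (l + 1)) *
          gT d (l + 1 + 1) q l) * incl d (l + 1) q c2)) =
        z • (c1 * pB R (tT d (l + 1) q l) a * c2) := by
      rw [← mul_assoc, ← mul_assoc, hc1, cexp_mul_incl, mul_assoc (incl _ _ _ _), cexp_incl_mul,
        cexp_peg, mul_smul_comm, smul_mul_assoc]
    have g1 : incl d (l + 1) q c1 * (z • (gT d (l + 1 + 1) q l * gT d (l + 1 + 1) q l)) *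
        incl d (l + 1) q c2 = z • (incl d (l + 1) q c1 * incl d (l + 1) q c2) +
        (z * ((q : R) - ((q⁻¹ : Rˣ) : R))) • (incl d (l + 1) q c1 *
          (eB R d (tT d (l + 1 + 1) q l) (tT d (l + 1 + 1) q (l + 1)) *
          gT d (l + 1 + 1) q l) * incl d (l + 1) q c2) := by
      rw [H.quad l (by omega), smul_add, mul_add, add_mul, mul_smul_comm, mul_one, smul_mul_assoc,
        mul_smul_comm, mul_smul_comm, smul_mul_assoc, smul_mul_assoc, smul_smul]
    rw [sand_bimod, sand_g, sand_p z w, g1, add_mul, mul_add, smul_mul_assoc, smul_mul_assoc,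
      mul_smul_comm, mul_smul_comm, one_mul]
    simp only [map_add, map_smul, tau_succ z w (n := l + 1), f1, f2, f3, f4, smul_eq_mul]
    ring

theorem sand_symm_g (k : ℕ) (hT : Tracial d q z w (k + 1 + 1)) (c1 c2 : Y R d (k + 1) q) :
    tau d q z w (k + 1 + 1) (gT d (k + 1 + 1) q k * gT d (k + 1 + 1) q k *
      (incl d (k + 1) q c1 * gT d (k + 1 + 1) q k * incl d (k + 1) q c2)) =
    tau d q z w (k + 1 + 1) (gT d (k + 1 + 1) q k * (incl d (k + 1) q c1 *
      (gT d (k + 1 + 1) q k * gT d (k + 1 + 1) q k) * incl d (k + 1) q c2)) := by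
  have H := isRep_Y (R := R) (d := d) (n := k + 1 + 1) (q := q)
  have hg := cexp_g (d := d) (q := q) z w (show 1 ≤ k + 1 by omega)
  rw [Nat.add_sub_cancel] at hg
  set h := gT d (k + 1 + 1) q k with hh
  set b1 := incl d (k + 1) q c1 with hb1
  set b2 := incl d (k + 1) q c2 with hb2
  set t0 := tT d (k + 1 + 1) q k with ht0
  set t1 := tT d (k + 1 + 1) q (k + 1) with ht1
  have hX : Commute t0 (h * b1 * h) := by
    have e1 : t0 * h = h * t1 := H.tg0 k (by omega)
    have e2 : t1 * b1 = b1 * t1 := (t_commute_incl c1).eq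
    have e3 : t1 * h = h * t0 := H.tg1 k (by omega)
    change t0 * (h * b1 * h) = h * b1 * h * t0
    rw [← mul_assoc, ← mul_assoc, e1, mul_assoc h t1, e2, mul_assoc, mul_assoc b1, e3]
    simp only [mul_assoc]
  have h12 : Commute t1 b2 := t_commute_incl c2
  have h01 : Commute t0 t1 := H.tt _ _ (by omega) (by omega)
  have he : tau d q z w (k + 1 + 1) (eB R d t0 t1 * (h * b1 * h * b2)) =
      tau d q z w (k + 1 + 1) (h * b1 * h * eB R d t0 t1 * b2) := by
    rw [eB, smul_mul_assoc, mul_smul_comm, smul_mul_assoc, map_smul, map_smul, Finset.sum_mul,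
      Finset.mul_sum, Finset.sum_mul, map_sum, map_sum]
    congr 1
    refine Finset.sum_congr rfl fun s _ => ?_
    have f1 := (h01.pow_pow s.val (-s).val).eq
    have f2 := (hX.pow_left s.val).eq
    have f3 := (h12.pow_left (-s).val).eq
    calc _ = tau d q z w (k + 1 + 1) (t1 ^ (-s).val * (t0 ^ s.val * (h * b1 * h) * b2)) := by
          rw [f1]; simp only [mul_assoc]
      _ = tau d q z w (k + 1 + 1) (t0 ^ s.val * (h * b1 * h) * b2 * t1 ^ (-s).val) := hT _ _
      _ = _ := by rw [f2, mul_assoc _ b2, ← f3]; simp only [mul_assoc]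
  have e1 : h * h * (b1 * h * b2) = b1 * h * b2 +
      ((q : R) - ((q⁻¹ : Rˣ) : R)) • (eB R d t0 t1 * (h * b1 * h * b2)) := by
    rw [H.quad k (by omega), add_mul, one_mul, smul_mul_assoc]
    simp only [mul_assoc]
    rfl
  have e2 : h * (b1 * (h * h) * b2) = h * b1 * b2 +
      ((q : R) - ((q⁻¹ : Rˣ) : R)) • (h * b1 * h * eB R d t0 t1 * b2) := by
    rw [H.quad k (by omega), H.e_comm k (by omega), mul_add, add_mul, mul_add, mul_one,
      mul_smul_comm, smul_mul_assoc, mul_smul_comm]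
    simp only [mul_assoc]
    rfl
  have e3 : tau d q z w (k + 1 + 1) (b1 * h * b2) = tau d q z w (k + 1 + 1) (h * b1 * b2) := by
    rw [tau_succ (n := k + 1), tau_succ (n := k + 1), hb1, hb2, mul_assoc h, ← map_mul, cexp_mul_incl, cexp_mul_incl,
      cexp_incl_mul, hg, smul_mul_assoc, mul_smul_comm, smul_mul_assoc, one_mul, mul_one]
  rw [e1, e2, map_add, map_add, map_smul, map_smul, he, e3]

theorem sand_symm (k : ℕ) (hT : Tracial d q z w (k + 1))
    (b c : Y R d (k + 1) q) :
    tau d q z w (k + 1) (sand d k q z w b * c) = tau d q z w (k + 1) (b * sand d k q z w c) := by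
  induction b using span_induction generalizing c with
  | hadd x y hx hy => rw [sand_add, add_mul, map_add, hx, hy, add_mul, map_add]
  | h0 => rw [sand_zero, zero_mul, zero_mul]
  | ht a b' =>
    rw [sand_right, mul_assoc, sand_symm_p z w k, sand_left, mul_assoc]
  | hg hk b1 b2 =>
    obtain ⟨l, rfl⟩ : ∃ l, k = l + 1 := ⟨k - 1, by omega⟩
    rw [Nat.add_sub_cancel]
    have key : ∀ c, tau d q z w (l + 1 + 1) (sand d (l + 1) q z w (gT d (l + 1 + 1) q l) * c) =
        tau d q z w (l + 1 + 1) (gT d (l + 1 + 1) q l * sand d (l + 1) q z w c) := fun c => by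
      induction c using span_induction with
      | hadd x y hx hy => rw [mul_add, map_add, hx, hy, sand_add, mul_add, map_add]
      | h0 => rw [sand_zero, mul_zero, mul_zero]
      | ht a c =>
        have := sand_symm_p z w (l + 1) a (incl d (l + 1) q c * gT d (l + 1 + 1) q l)
        rw [sand_left, ← mul_assoc, ← mul_assoc] at this
        rw [sand_right, hT, hT (gT d (l + 1 + 1) q l), this]
      | hg hk c1 c2 =>
        rw [Nat.add_sub_cancel, sand_bimod, sand_g, smul_mul_assoc, mul_smul_comm, smul_mul_assoc,
          mul_smul_comm, map_smul, map_smul, sand_symm_g z w l hT]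
    have h1 := key (incl d (l + 1) q b2 * c * incl d (l + 1) q b1)
    rw [sand_bimod] at h1 ⊢
    calc _ = tau d q z w (l + 1 + 1) (sand d (l + 1) q z w (gT d (l + 1 + 1) q l) *
          (incl d (l + 1) q b2 * c * incl d (l + 1) q b1)) := by
          rw [mul_assoc, mul_assoc, hT]; simp only [mul_assoc]
      _ = _ := h1
      _ = _ := by
          rw [mul_assoc (incl d (l + 1) q b1), mul_assoc (incl d (l + 1) q b1),
            hT (incl d (l + 1) q b1)]
          simp only [mul_assoc]

theorem tracial : ∀ n, Tracial d q z w n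
  | 0 => fun x y => by
    change Y.lift _ _ = Y.lift _ _
    rw [map_mul, map_mul, mul_comm]
  | n + 1 => fun x => by
    have hT := tracial n
    have hincl : ∀ (c : Y R d n q) y, tau d q z w (n + 1) (incl d n q c * y) =
        tau d q z w (n + 1) (y * incl d n q c) := fun c y => by
      rw [tau_succ, tau_succ, cexp_incl_mul, cexp_mul_incl, hT]
    have H := isRep_Y (R := R) (d := d) (n := n + 1) (q := q)
    let S : Subalgebra R (Y R d (n + 1) q) :=
      { carrier := {x | ∀ y, tau d q z w (n + 1) (x * y) = tau d q z w (n + 1) (y * x)}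
        mul_mem' := fun {a b} ha hb y => by
          rw [mul_assoc, ha, mul_assoc, hb, mul_assoc]
        add_mem' := fun {a b} ha hb y => by
          rw [add_mul, mul_add, map_add, map_add, ha, hb]
        algebraMap_mem' := fun r y => by
          rw [Algebra.commutes] }
    refine Y.mem_of_gen S (fun i hi => ?_) (fun i hi => ?_) x
    · by_cases h : i + 1 < n
      · rw [← incl_gT i h]; exact hincl _
      obtain ⟨k, rfl⟩ : ∃ k, n = k + 1 := ⟨n - 1, by omega⟩
      have : i = k := by omega
      subst this
      intro y
      have hg := cexp_g (d := d) (q := q) z w (show 1 ≤ i + 1 by omega)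
      rw [Nat.add_sub_cancel] at hg
      induction y using span_induction with
      | hadd x y hx hy => rw [mul_add, add_mul, map_add, map_add, hx, hy]
      | h0 => rw [mul_zero, zero_mul]
      | ht a c =>
        have hc : pB R (tT d (i + 1 + 1) q (i + 1)) a * incl d (i + 1) q c =
            incl d (i + 1) q c * pB R (tT d (i + 1 + 1) q (i + 1)) a :=
          (pB_commute (t_commute_incl c).symm a).eq.symm
        rw [← mul_assoc, H.g_p0 i hi, hc, mul_assoc (incl _ _ _ c), tau_succ (n := i + 1), tau_succ (n := i + 1),
          cexp_mul_incl, cexp_incl_mul, cexp_pg, ← p_incl, cexp_incl_mul, hg, mul_smul_comm,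
          mul_one, hT]
      | hg hk b c =>
        have := sand_symm z w i hT b c
        rw [Nat.add_sub_cancel, tau_succ (n := i + 1), tau_succ (n := i + 1), ← mul_assoc, cexp_mul_incl, ← mul_assoc,
          mul_assoc (incl _ _ _ b), mul_assoc (incl _ _ _ b), cexp_incl_mul]
        exact this
    · by_cases h : i < n
      · rw [← incl_tT i h]; exact hincl _
      have : i = n := by omega
      subst this
      intro y
      induction y using span_induction with
      | hadd x y hx hy => rw [mul_add, add_mul, map_add, map_add, hx, hy]
      | h0 => rw [mul_zero, zero_mul]
      | ht a c =>
        have : Commute (tT d (i + 1) q i) (pB R (tT d (i + 1) q i) a * incl d i q c) :=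
          Commute.mul_right (pB_commute (Commute.refl _) a) (t_commute_incl c)
        rw [this.eq]
      | hg hk b c =>
        obtain ⟨k, rfl⟩ : ∃ k, i = k + 1 := ⟨i - 1, by omega⟩
        rw [Nat.add_sub_cancel]
        have hg := cexp_g (d := d) (q := q) z w (show 1 ≤ k + 1 by omega)
        rw [Nat.add_sub_cancel] at hg
        have hb := (t_commute_incl b).eq
        have hc := (t_commute_incl c).eq
        have e1 : tT d (k + 1 + 1) q (k + 1) * (incl d (k + 1) q b * gT d (k + 1 + 1) q k *
            incl d (k + 1) q c) = incl d (k + 1) q b * gT d (k + 1 + 1) q k *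
              incl d (k + 1) q (tT d (k + 1) q k * c) := by
          rw [← mul_assoc, ← mul_assoc, hb, mul_assoc _ (tT _ _ _ _), H.tg1 k (by omega), map_mul,
            incl_tT k (by omega)]
          simp only [mul_assoc]
        have e2 : (incl d (k + 1) q b * gT d (k + 1 + 1) q k * incl d (k + 1) q c) *
            tT d (k + 1 + 1) q (k + 1) = incl d (k + 1) q (b * tT d (k + 1) q k) *
              gT d (k + 1 + 1) q k * incl d (k + 1) q c := by
          rw [mul_assoc, ← hc, ← mul_assoc, mul_assoc _ (gT _ _ _ _), ← H.tg0 k (by omega), map_mul,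
            incl_tT k (by omega)]
          simp only [mul_assoc]
        rw [e1, e2, tau_succ (n := k + 1), tau_succ (n := k + 1), cexp_mul_incl, cexp_mul_incl, cexp_incl_mul, cexp_incl_mul, hg]
        simp only [mul_smul_comm, smul_mul_assoc, mul_one, mul_assoc]

theorem tau_incl (hw : ∑ a, w a = 1) (c : Y R d n q) :
    tau d q z w (n + 1) (incl d n q c) = tau d q z w n c := by
  have := cexp_mul_incl z w c 1
  rw [one_mul, cexp_one z w hw, one_mul] at this
  rw [tau_succ, this]

theorem tau_one (hw : ∑ a, w a = 1) : ∀ n, tau d q z w n 1 = 1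
  | 0 => by
    change Y.lift _ _ = _
    rw [map_one]
  | n + 1 => by rw [tau_succ, cexp_one z w hw, tau_one hw n]

end Trace
end
end Rep
end Algebra

/-! ### The E-system and the specialized trace -/

/-- The quantity `E^{(m)} = (1/d) ∑_s x_{m+s} x_{d-s}`, with subscripts modulo `d`. -/
def ESum {d : ℕ} [NeZero d] (x : ZMod d → ℂ) (m : ZMod d) : ℂ :=
  (1 / (d : ℂ)) * ∑ s : ZMod d, x (m + s) * x (-s)

/-- A solution `x_1, …, x_{d-1}` of the E-system, with subscripts modulo `d` and `x_0 = 1`. -/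
structure ESolution (d : ℕ) [NeZero d] where
  x : ZMod d → ℂ
  x_zero : x 0 = 1
  esystem : ∀ m : ZMod d, m ≠ 0 → ESum x m = x m * ESum x 0

/-- The rules of the specialized trace on the union of the algebras `Y_{d,n}(q)`. A linear map on
the union is a family of linear maps that is compatible with the inclusions. -/
structure IsSpecializedTrace {d : ℕ} [NeZero d] (x : ZMod d → ℂ) (q : ℂˣ)
    (tr : ∀ n, Y ℂ d n q →ₗ[ℂ] ℂ[X]) : Prop where
  tr_incl : ∀ (n : ℕ) (a : Y ℂ d n q), tr (n + 1) (incl d n q a) = tr n a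
  tr_mul_comm : ∀ (n : ℕ) (a b : Y ℂ d n q), tr n (a * b) = tr n (b * a)
  tr_one : ∀ n : ℕ, tr n 1 = 1
  tr_markov : ∀ (n : ℕ) (a : Y ℂ d (n + 1) q),
    tr (n + 2) (incl d (n + 1) q a * g d q ⟨n, by omega⟩) = Polynomial.X * tr (n + 1) a
  tr_framing : ∀ (n : ℕ) (a : Y ℂ d n q) (s : ℕ), 1 ≤ s → s ≤ d - 1 →
    tr (n + 1) (incl d n q a * t d q (Fin.last n) ^ s) = Polynomial.C (x s) * tr n a

section Existence

variable {d : ℕ} [NeZero d] {q : ℂˣ}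

theorem IsSpecializedTrace.unique {x : ZMod d → ℂ} {tr tr' : ∀ n, Y ℂ d n q →ₗ[ℂ] ℂ[X]}
    (h : IsSpecializedTrace x q tr) (h' : IsSpecializedTrace x q tr') : tr = tr' := by
  funext n
  induction n with
  | zero =>
    refine LinearMap.ext fun y => ?_
    have hy : y ∈ (⊥ : Subalgebra ℂ (Y ℂ d 0 q)) :=
      Y.mem_of_gen _ (fun i hi => by omega) (fun i hi => by omega) y
    obtain ⟨r, rfl⟩ := Algebra.mem_bot.1 hy
    rw [Algebra.algebraMap_eq_smul_one, map_smul, map_smul, h.tr_one, h'.tr_one]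
  | succ n ih =>
    refine LinearMap.ext fun y => ?_
    induction y using span_induction with
    | hadd x y hx hy => rw [map_add, map_add, hx, hy]
    | h0 => rw [map_zero, map_zero]
    | ht a c =>
      have key : ∀ s : ZMod d, tr (n + 1) (tT d (n + 1) q n ^ s.val * incl d n q c) =
          tr' (n + 1) (tT d (n + 1) q n ^ s.val * incl d n q c) := fun s => by
        have hs := ZMod.val_lt s
        rw [h.tr_mul_comm, h'.tr_mul_comm, tT_eq n (by omega)]
        rcases Nat.eq_zero_or_pos s.val with h0 | h0
        · rw [h0, pow_zero, mul_one, h.tr_incl, h'.tr_incl, ih]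
        · have e := h.tr_framing n c s.val h0 (by omega)
          have e' := h'.tr_framing n c s.val h0 (by omega)
          rw [ih] at e
          exact e.trans e'.symm
      rw [pB, smul_mul_assoc, map_smul, map_smul, Finset.sum_mul, map_sum, map_sum]
      congr 1
      refine Finset.sum_congr rfl fun s _ => ?_
      rw [smul_mul_assoc, map_smul, map_smul, key]
    | hg hn b c =>
      obtain ⟨k, rfl⟩ : ∃ k, n = k + 1 := ⟨n - 1, by omega⟩
      rw [Nat.add_sub_cancel, h.tr_mul_comm, h'.tr_mul_comm, ← mul_assoc, ← map_mul,
        gT_eq k (by omega)]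
      have e := h.tr_markov k (c * b)
      have e' := h'.tr_markov k (c * b)
      rw [ih] at e
      exact e.trans e'.symm

/-- The parameter `q` as a unit of `ℂ[X]`. -/
def qX (q : ℂˣ) : ℂ[X]ˣ := Units.map (Polynomial.C : ℂ →+* ℂ[X]).toMonoidHom q

/-- Extension of scalars to `ℂ[X]`. -/
theorem isRep_baseChange (n : ℕ) : IsRep (R := ℂ) (B := Y ℂ[X] d n (qX q)) d n
    ((q : ℂ) - ((q⁻¹ : ℂˣ) : ℂ)) (gT d n (qX q))
    (tT d n (qX q)) where
  braid := isRep_Y.braid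
  far := isRep_Y.far
  tt := isRep_Y.tt
  tg0 := isRep_Y.tg0
  tg1 := isRep_Y.tg1
  tg := isRep_Y.tg
  td := isRep_Y.td
  quad i h := by
    have := (isRep_Y (R := ℂ[X]) (d := d) (n := n) (q := qX q)).quad i h
    rw [this]
    have e1 : ∀ y : Y ℂ[X] d n (qX q),
        ((qX q : ℂ[X]) -
          (((qX q)⁻¹ : ℂ[X]ˣ) : ℂ[X])) • y =
          ((q : ℂ) - ((q⁻¹ : ℂˣ) : ℂ)) • y := fun y => by
      have c1 : ((qX q : ℂ[X]ˣ) : ℂ[X]) = Polynomial.C (q : ℂ) := rfl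
      have c2 : (((qX q)⁻¹ : ℂ[X]ˣ) : ℂ[X]) = Polynomial.C ((q⁻¹ : ℂˣ) : ℂ) := rfl
      rw [← algebraMap_smul ℂ[X] ((q : ℂ) - ((q⁻¹ : ℂˣ) : ℂ)) y, c1, c2, ← map_sub]
      rfl
    rw [e1, eB, eB, invd, invd, algebraMap_smul]
    rfl

/-- The weights of the eigenspaces of the framing generators. -/
def weight (x : ZMod d → ℂ) (a : ZMod d) : ℂ :=
  (d : ℂ)⁻¹ * ∑ s : ZMod d, ZMod.stdAddChar (-(s * a)) * x s

theorem sum_weight (x : ZMod d → ℂ) (s : ZMod d) :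
    ∑ a : ZMod d, ZMod.stdAddChar (s * a) * weight x a = x s := by
  have h := congrFun (LinearEquiv.symm_apply_apply (ZMod.dft (N := d) (E := ℂ)) x) s
  rw [ZMod.invDFT_apply] at h
  conv_rhs => rw [← h]
  rw [smul_eq_mul, Finset.mul_sum]
  refine Finset.sum_congr rfl fun a _ => ?_
  rw [weight, ZMod.dft_apply, mul_comm s a]
  simp only [smul_eq_mul]
  ring

theorem exists_specializedTrace {x : ZMod d → ℂ} (hx : x 0 = 1) (q : ℂˣ) :
    ∃ tr, IsSpecializedTrace x q tr := by
  set Q : ℂ[X]ˣ := qX q with hQ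
  let w : ZMod d → ℂ[X] := fun a => Polynomial.C (weight x a)
  have hs : ∀ s : ZMod d, ∑ a, chi ℂ[X] (s * a) * w a = Polynomial.C (x s) := fun s => by
    rw [← sum_weight x s, map_sum]
    refine Finset.sum_congr rfl fun a _ => ?_
    rw [map_mul]; rfl
  have hw : ∑ a, w a = 1 := by
    have := hs 0
    rw [hx, map_one] at this
    rw [← this]
    refine Finset.sum_congr rfl fun a _ => ?_
    rw [zero_mul, chi_zero, one_mul]
  let bc : ∀ n, Y ℂ d n q →ₐ[ℂ] Y ℂ[X] d n Q := fun n => Y.lift (isRep_baseChange n)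
  have hbc : ∀ n a, bc (n + 1) (incl d n q a) = incl d n Q (bc n a) := fun n a => by
    have : (bc (n + 1)).comp (incl d n q) = ((incl d n Q).restrictScalars ℂ).comp (bc n) := by
      refine Y.hom_ext (fun i h => ?_) (fun j h => ?_)
      · change bc (n + 1) (incl d n q _) = incl d n Q (bc n _)
        rw [incl_gT i h]
        change Y.lift _ _ = incl d n Q (Y.lift _ _)
        rw [Y.lift_gT _ i (by omega), Y.lift_gT _ i h, incl_gT i h]
      · change bc (n + 1) (incl d n q _) = incl d n Q (bc n _)
        rw [incl_tT j h]
        change Y.lift _ _ = incl d n Q (Y.lift _ _)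
        rw [Y.lift_tT _ j (by omega), Y.lift_tT _ j h, incl_tT j h]
    exact DFunLike.congr_fun this a
  refine ⟨fun n => ((tau d Q Polynomial.X w n).restrictScalars ℂ).comp (bc n).toLinearMap,
    ⟨fun n a => ?_, fun n a b => ?_, fun n => ?_, fun n a => ?_, fun n a s h1 h2 => ?_⟩⟩
  · change tau d Q Polynomial.X w (n + 1) (bc (n + 1) _) = tau d Q Polynomial.X w n (bc n a)
    rw [hbc, tau_incl _ w hw]
  · change tau d Q Polynomial.X w n (bc n _) = tau d Q Polynomial.X w n (bc n _)
    rw [map_mul (bc n), map_mul (bc n), tracial]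
  · change tau d Q Polynomial.X w n (bc n _) = _
    rw [map_one, tau_one _ w hw]
  · change tau d Q Polynomial.X w (n + 2) (bc (n + 2) _) =
      _ * tau d Q Polynomial.X w (n + 1) (bc (n + 1) a)
    have e : bc (n + 2) (g d q ⟨n, by omega⟩) = gT d (n + 2) Q n := Y.lift_g _ _
    have hg := cexp_g (d := d) (q := Q) Polynomial.X w (show 1 ≤ n + 1 by omega)
    rw [Nat.add_sub_cancel] at hg
    rw [map_mul, hbc, e, tau_succ, cexp_incl_mul, hg, mul_smul_comm, mul_one, map_smul, smul_eq_mul]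
  · change tau d Q Polynomial.X w (n + 1) (bc (n + 1) _) =
      _ * tau d Q Polynomial.X w n (bc n a)
    have e : bc (n + 1) (t d q (Fin.last n)) = tT d (n + 1) Q n := Y.lift_t _ _
    rw [map_mul, hbc, map_pow, e, tau_succ, cexp_incl_mul, cexp_t_pow, mul_smul_comm, mul_one,
      map_smul, smul_eq_mul, hs]

end Existence

section Invariant

variable {d : ℕ} [NeZero d]

/-- The specialized trace `tr_{d,D} : ⋃_n Y_{d,n}(q) → ℂ[z]`: the unique family of maps satisfying
the rules above, for the solution `X_D` of the E-system. -/
def specializedTrace (S : ESolution d) (q : ℂˣ) : ∀ n, Y ℂ d n q →ₗ[ℂ] ℂ[X] :=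
  Classical.choose (exists_specializedTrace S.x_zero q)

theorem specializedTrace_spec (S : ESolution d) (q : ℂˣ) :
    IsSpecializedTrace S.x q (specializedTrace S q) :=
  Classical.choose_spec (exists_specializedTrace S.x_zero q)

/-- The number `E_D = (1/d) ∑_s x_s x_{d-s}`. -/
def ESolution.E (S : ESolution d) : ℂ := ESum S.x 0

/-- `E_D` is the value of the specialized trace at the elements `e_i`. -/
theorem specializedTrace_e (S : ESolution d) (q : ℂˣ) (n : ℕ) :
    specializedTrace S q (n + 2) (mkY ℂ d (n + 2) q (idem ℂ d ⟨n, by omega⟩)) =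
      Polynomial.C S.E := by
  have h := specializedTrace_spec S q
  have hfr : ∀ (n : ℕ) (a : Y ℂ d n q) (s : ZMod d), specializedTrace S q (n + 1)
      (incl d n q a * t d q (Fin.last n) ^ s.val) =
        Polynomial.C (S.x s) * specializedTrace S q n a := fun n a s => by
    rcases Nat.eq_zero_or_pos s.val with h0 | h0
    · rw [h0, pow_zero, mul_one, h.tr_incl, (ZMod.val_eq_zero s).1 h0, S.x_zero, map_one, one_mul]
    · have := ZMod.val_lt s
      rw [h.tr_framing n a s.val h0 (by omega), ZMod.natCast_zmod_val]
  have e1 : (t d q (BraidGen.left (⟨n, by omega⟩ : BraidGen (n + 2))) : Y ℂ d (n + 2) q) =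
      incl d (n + 1) q (t d q (Fin.last n)) := by
    have := incl_tT (R := ℂ) (d := d) (q := q) (n := n + 1) n (by omega)
    rw [tT_eq _ (by omega), tT_eq _ (by omega)] at this
    exact this.symm
  have e2 : ∀ s : ZMod d, specializedTrace S q (n + 2)
      ((t d q (BraidGen.left (⟨n, by omega⟩ : BraidGen (n + 2))) : Y ℂ d (n + 2) q) ^ s.val *
        t d q (BraidGen.right (⟨n, by omega⟩ : BraidGen (n + 2))) ^ (-s).val) =
      Polynomial.C (S.x s * S.x (-s)) := fun s => by
    have h1 := hfr (n + 1) (t d q (Fin.last n) ^ s.val) (-s)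
    have h2 := hfr n 1 s
    rw [map_one, one_mul, h.tr_one, mul_one] at h2
    rw [h2, map_pow, ← e1] at h1
    rw [mul_comm (S.x s), map_mul Polynomial.C]
    exact h1
  rw [mkAlgHom_idem, eB, map_smul, map_sum, Finset.sum_congr rfl fun s _ => e2 s, ← map_sum,
    Polynomial.smul_C, ESolution.E, ESum, invd]
  simp

/-- `λ_D = (z - (q - q⁻¹) E_D) / z`. -/
def lam (S : ESolution d) (q : ℂˣ) (z : ℂ) : ℂ :=
  (z - ((q : ℂ) - ((q⁻¹ : ℂˣ) : ℂ)) * S.E) / z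

/-- The value `Θ_{d,D}(q, z)(α̂) = Λ_D^{n-1} (√λ_D)^{ε(α)} tr_{d,D}(α)` on the closure of a braid
`α ∈ B_n`, where `Λ_D = 1 / (z √λ_D)`. The argument `r` is the chosen square root of `λ_D`. -/
def theta (S : ESolution d) (q : ℂˣ) (z r : ℂ) {n : ℕ} (α : BraidGroup n) : ℂ :=
  (1 / (z * r)) ^ ((n : ℤ) - 1) * r ^ exponentSum α *
    (specializedTrace S q n (braidToY ℂ d n q α)).eval z

/-- The invariant in the variables `q` and `λ_D`, by the change of variables
`z = (q - q⁻¹) E_D / (1 - λ_D)`. The argument `r` is the chosen square root of `l = λ_D`. -/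
def thetaLam (S : ESolution d) (q : ℂˣ) (l r : ℂ) {n : ℕ} (α : BraidGroup n) : ℂ :=
  theta S q (((q : ℂ) - ((q⁻¹ : ℂˣ) : ℂ)) * S.E / (1 - l)) r α

end Invariant

end YH
end

/-!
Sending `g_i` to `g_i⁻¹ = g_i - (q - q⁻¹) e_i` and fixing `t_j` defines a homomorphism
`Y_{d,n}(q⁻¹) → Y_{d,n}(q)` that intertwines the images of `α` and `α^*`. The E-system says exactly
that `e_n` factors out of the trace, `tr(a e_n) = E_D tr(a)` for `a ∈ Y_{d,n}`, and this turns the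
Markov rule for `g_n` into `tr(a g_n⁻¹) = (z - (q - q⁻¹) E_D) tr(a)`. Pulled back along the
homomorphism and followed by the substitution `z ↦ z + (q - q⁻¹) E_D`, the trace for `q` therefore
satisfies the rules of the trace for `q⁻¹`, and the two agree by uniqueness.
-/

noncomputable section

namespace YH

section Braid

variable {n : ℕ}

theorem BraidGroup.hom_ext {M : Type*} [Monoid M] {f f' : BraidGroup n →* M}
    (h : ∀ i, f (σ i) = f' (σ i)) : f = f' :=
  MonoidHom.eq_of_eqOn_dense (PresentedGroup.closure_range_of _) (Set.forall_mem_range.2 h)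

theorem mirror_σ (i : BraidGen n) : mirror n (σ i) = (σ i)⁻¹ :=
  BraidGroup.lift_σ _ _ _ i

theorem exponentSum_mirror (α : BraidGroup n) : exponentSum (mirror n α) = -exponentSum α := by
  have h : (exponentSumHom n).comp (mirror n) = (exponentSumHom n)⁻¹ :=
    BraidGroup.hom_ext fun i => by
      rw [MonoidHom.comp_apply, mirror_σ, map_inv, MonoidHom.inv_apply]
  exact congrArg Multiplicative.toAdd (DFunLike.congr_fun h α)

end Braid

section Mirror

variable {R : Type} [CommRing R] [Algebra ℂ R] {d : ℕ} [NeZero d] {n : ℕ}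
  {B : Type} [Ring B] [Algebra R B]

/-- The inverse `g_i - v e_i` of the `i`-th braiding generator of a representation of the relations
of the Yokonuma--Hecke algebra with parameter `v`. It is given by this formula, and not as the
inverse of a unit, so that it makes sense for every index `i`. -/
def invGen (d : ℕ) [NeZero d] (v : R) (gg tt : ℕ → B) (i : ℕ) : B :=
  gg i - v • eB R d (tt i) (tt (i + 1))

namespace IsRep

variable {v : R} {gg tt : ℕ → B}

theorem val_inv_unit (H : IsRep d n v gg tt) (i : ℕ) (h : i + 1 < n) :
    ((H.unit i h)⁻¹ : Bˣ) = invGen d v gg tt i :=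
  rfl

theorem invGen_semiconj (H : IsRep d n v gg tt) {i : ℕ} (h : i + 1 < n) {x y : B}
    (hxy : x * gg i = gg i * y) : y * invGen d v gg tt i = invGen d v gg tt i * x :=
  have : SemiconjBy (H.unit i h : B) y x := hxy.symm
  this.units_inv_symm_left.eq.symm

theorem inverse (H : IsRep d n v gg tt) : IsRep d n (-v) (invGen d v gg tt) tt where
  braid i h := by
    have braid : H.unit i (by omega) * H.unit (i + 1) h * H.unit i (by omega) =
        H.unit (i + 1) h * H.unit i (by omega) * H.unit (i + 1) h :=
      Units.ext (H.braid i h)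
    simpa only [mul_inv_rev, Units.val_mul, ← mul_assoc, val_inv_unit] using
      congrArg Units.val (congrArg Inv.inv braid)
  far i j h h' := by
    have far : H.unit j h' * H.unit i (by omega) = H.unit i (by omega) * H.unit j h' :=
      Units.ext (H.far i j h h').symm
    simpa only [mul_inv_rev, Units.val_mul, val_inv_unit] using
      congrArg Units.val (congrArg Inv.inv far)
  tt := H.tt
  tg0 i h := H.invGen_semiconj h (H.tg1 i h)
  tg1 i h := H.invGen_semiconj h (H.tg0 i h)
  tg i j h h' h1 h2 := H.invGen_semiconj h (H.tg i j h h' h1 h2)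
  td := H.td
  quad i h := by
    have mul_invGen : gg i * invGen d v gg tt i = 1 := (H.unit i h).mul_inv
    nth_rw 1 [invGen]
    rw [sub_mul, mul_invGen, smul_mul_assoc, neg_smul, sub_eq_add_neg]

end IsRep

variable {q : Rˣ}

theorem isRep_Y_inverse :
    IsRep d n (((q⁻¹ : Rˣ) : R) - (((q⁻¹)⁻¹ : Rˣ) : R))
      (invGen d ((q : R) - ((q⁻¹ : Rˣ) : R)) (gT d n q) (tT d n q)) (tT d n q) := by
  simpa only [neg_sub, inv_inv] using (isRep_Y (R := R) (d := d) (n := n) (q := q)).inverse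

/-- The homomorphism `Y_{d,n}(q⁻¹) → Y_{d,n}(q)` with `g_i ↦ g_i⁻¹` and `t_j ↦ t_j`, which carries
the passage to the mirror image of a braid over to the Yokonuma--Hecke algebras. -/
def Y.mirror (R : Type) [CommRing R] [Algebra ℂ R] (d n : ℕ) [NeZero d] (q : Rˣ) :
    Y R d n q⁻¹ →ₐ[R] Y R d n q :=
  Y.lift isRep_Y_inverse

theorem Y.mirror_gT (i : ℕ) (h : i + 1 < n) : Y.mirror R d n q (gT d n q⁻¹ i) =
    invGen d ((q : R) - ((q⁻¹ : Rˣ) : R)) (gT d n q) (tT d n q) i :=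
  Y.lift_gT _ i h

theorem Y.mirror_tT (j : ℕ) (h : j < n) : Y.mirror R d n q (tT d n q⁻¹ j) = tT d n q j :=
  Y.lift_tT _ j h

theorem Y.mirror_incl (a : Y R d n q⁻¹) :
    Y.mirror R d (n + 1) q (incl d n q⁻¹ a) = incl d n q (Y.mirror R d n q a) := by
  have h : (Y.mirror R d (n + 1) q).comp (incl d n q⁻¹) =
      (incl d n q).comp (Y.mirror R d n q) := by
    refine Y.hom_ext (fun i hi => ?_) (fun j hj => ?_)
    · rw [AlgHom.comp_apply, AlgHom.comp_apply, incl_gT i hi, Y.mirror_gT i hi,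
        Y.mirror_gT i (by omega), invGen, invGen, map_sub, map_smul, map_eB, incl_gT i hi,
        incl_tT i (by omega), incl_tT (i + 1) hi]
    · rw [AlgHom.comp_apply, AlgHom.comp_apply, incl_tT j hj, Y.mirror_tT j hj,
        Y.mirror_tT j (by omega), incl_tT j hj]
  exact DFunLike.congr_fun h a

theorem braidToY_σ (i : BraidGen n) : braidToY R d n q (σ i) = gT d n q i.1 := by
  rw [gT_eq _ i.2, braidToY, MonoidHom.comp_apply, braidToFramed, BraidGroup.lift_σ]
  rfl

theorem braidToY_σ_inv (i : BraidGen n) : braidToY R d n q (σ i)⁻¹ =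
    invGen d ((q : R) - ((q⁻¹ : Rˣ) : R)) (gT d n q) (tT d n q) i.1 := by
  refine left_inv_eq_right_inv (a := gT d n q i.1) ?_ (isRep_Y.unit i.1 i.2).mul_inv
  rw [← braidToY_σ, ← map_mul, inv_mul_cancel, map_one]

theorem braidToY_mirror (α : BraidGroup n) :
    braidToY R d n q (mirror n α) = Y.mirror R d n q (braidToY R d n q⁻¹ α) := by
  have h : (braidToY R d n q).comp (mirror n) =
      (Y.mirror R d n q : Y R d n q⁻¹ →* Y R d n q).comp (braidToY R d n q⁻¹) :=
    BraidGroup.hom_ext fun i => by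
      rw [MonoidHom.comp_apply, MonoidHom.comp_apply, mirror_σ, braidToY_σ_inv, braidToY_σ,
        MonoidHom.coe_coe, Y.mirror_gT _ i.2]
  exact DFunLike.congr_fun h α

theorem Y.linearMap_ext {M : Type*} [AddCommMonoid M] [Module R M]
    {f f' : Y R d (n + 1) q →ₗ[R] M}
    (hpow : ∀ (c : Y R d n q) (s : ZMod d),
      f (incl d n q c * tT d (n + 1) q n ^ s.val) = f' (incl d n q c * tT d (n + 1) q n ^ s.val))
    (hg : 1 ≤ n → ∀ b c : Y R d n q,
      f (incl d n q b * gT d (n + 1) q (n - 1) * incl d n q c) =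
        f' (incl d n q b * gT d (n + 1) q (n - 1) * incl d n q c)) : f = f' := by
  refine LinearMap.ext fun y => ?_
  induction y using span_induction with
  | hadd x y hx hy => rw [map_add, map_add, hx, hy]
  | h0 => rw [map_zero, map_zero]
  | ht a c =>
    rw [← (pB_commute (t_commute_incl c).symm a).eq, pB]
    simp only [mul_smul_comm, Finset.mul_sum, map_smul, map_sum, hpow]
  | hg hn b c => exact hg hn b c

end Mirror

section Trace

variable {d : ℕ} [NeZero d]

theorem ESolution.ESum_eq (S : ESolution d) (m : ZMod d) : ESum S.x m = S.x m * S.E := by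
  rcases eq_or_ne m 0 with rfl | hm
  · rw [S.x_zero, one_mul, ESolution.E]
  · exact S.esystem m hm

/-- The conditional expectation `(1/d) ∑_s x_{-s} y^s` of the idempotent `(1/d) ∑_s y^s t^{-s}`,
in which the framing generator `t` of the last strand is integrated out: the trace turns `t^{-s}`
into `x_{-s}`. -/
def idemExpectation {B : Type} [Ring B] [Algebra ℂ B] (x : ZMod d → ℂ) (y : B) : B :=
  (d : ℂ)⁻¹ • ∑ s : ZMod d, x (-s) • y ^ s.val

section Ring

variable {B B' : Type} [Ring B] [Algebra ℂ B] [Ring B'] [Algebra ℂ B'] {x : ZMod d → ℂ}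

theorem map_idemExpectation (f : B →ₐ[ℂ] B') (y : B) :
    f (idemExpectation x y) = idemExpectation x (f y) := by
  simp only [idemExpectation, map_smul, map_sum, map_pow]

theorem idemExpectation_semiconj {c y y' : B} (h : SemiconjBy c y y') :
    SemiconjBy c (idemExpectation x y) (idemExpectation x y') := by
  simp only [SemiconjBy, idemExpectation, mul_smul_comm, smul_mul_assoc, Finset.mul_sum,
    Finset.sum_mul, (h.pow_right _).eq]

end Ring

namespace IsSpecializedTrace

variable {q : ℂˣ} {tr : ∀ n, Y ℂ d n q →ₗ[ℂ] ℂ[X]}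

section Rules

variable {x : ZMod d → ℂ}

theorem tr_framing_val (h : IsSpecializedTrace x q tr) (hx : x 0 = 1) (n : ℕ) (a : Y ℂ d n q)
    (s : ZMod d) : tr (n + 1) (incl d n q a * tT d (n + 1) q n ^ s.val) =
      Polynomial.C (x s) * tr n a := by
  rw [tT_eq n (by omega)]
  rcases Nat.eq_zero_or_pos s.val with hs | hs
  · rw [hs, pow_zero, mul_one, h.tr_incl, (ZMod.val_eq_zero s).1 hs, hx, map_one, one_mul]
  · have framing := h.tr_framing n a s.val hs (Nat.le_sub_one_of_lt (ZMod.val_lt s))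
    rwa [ZMod.natCast_zmod_val] at framing

theorem tr_markov_gT (h : IsSpecializedTrace x q tr) (n : ℕ) (a : Y ℂ d (n + 1) q) :
    tr (n + 2) (incl d (n + 1) q a * gT d (n + 2) q n) = Polynomial.X * tr (n + 1) a := by
  rw [gT_eq n (by omega), h.tr_markov]

theorem tr_mul_gT_mul (h : IsSpecializedTrace x q tr) (n : ℕ) (b c : Y ℂ d (n + 1) q) :
    tr (n + 2) (incl d (n + 1) q b * gT d (n + 2) q n * incl d (n + 1) q c) =
      Polynomial.X * tr (n + 1) (c * b) := by
  rw [h.tr_mul_comm, ← mul_assoc, ← map_mul, h.tr_markov_gT]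

theorem tr_incl_mul_eB (h : IsSpecializedTrace x q tr) (hx : x 0 = 1) (n : ℕ)
    (a : Y ℂ d (n + 1) q) :
    tr (n + 2) (incl d (n + 1) q a * eB ℂ d (tT d (n + 2) q n) (tT d (n + 2) q (n + 1))) =
      tr (n + 1) (a * idemExpectation x (tT d (n + 1) q n)) := by
  rw [eB, idemExpectation, mul_smul_comm, mul_smul_comm, map_smul, map_smul, Finset.mul_sum,
    Finset.mul_sum, map_sum, map_sum]
  refine congrArg _ (Finset.sum_congr rfl fun s _ => ?_)
  rw [← incl_tT n (by omega), ← map_pow, ← mul_assoc, ← map_mul, h.tr_framing_val hx,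
    mul_smul_comm, map_smul, Polynomial.smul_eq_C_mul]

theorem tr_framing_mul_idemExpectation (h : IsSpecializedTrace x q tr) (hx : x 0 = 1) (n : ℕ)
    (c : Y ℂ d n q) (m : ZMod d) :
    tr (n + 1) (incl d n q c * tT d (n + 1) q n ^ m.val *
        idemExpectation x (tT d (n + 1) q n)) =
      Polynomial.C (ESum x m) * tr n c := by
  have td : (tT d (n + 1) q n : Y ℂ d (n + 1) q) ^ d = 1 := isRep_Y.td n (by omega)
  simp only [idemExpectation, mul_smul_comm, Finset.mul_sum, map_smul, map_sum, mul_assoc,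
    ← pow_val_add td, h.tr_framing_val hx, ESum, one_div, Polynomial.smul_eq_C_mul, map_mul,
    Finset.sum_mul, mul_left_comm]

end Rules

variable {S : ESolution d}

theorem gT_mul_idemExpectation {x : ZMod d → ℂ} (n : ℕ) :
    gT d (n + 2) q n * idemExpectation x (tT d (n + 2) q (n + 1) : Y ℂ d (n + 2) q) =
      incl d (n + 1) q (idemExpectation x (tT d (n + 1) q n)) * gT d (n + 2) q n := by
  have tg : SemiconjBy (gT d (n + 2) q n : Y ℂ d (n + 2) q) (tT d (n + 2) q (n + 1))
      (tT d (n + 2) q n) := (isRep_Y.tg0 n (by omega)).symm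
  rw [map_idemExpectation, incl_tT n (by omega), (idemExpectation_semiconj tg).eq]

theorem tr_mul_idemExpectation (h : IsSpecializedTrace S.x q tr) (n : ℕ) (a : Y ℂ d (n + 1) q) :
    tr (n + 1) (a * idemExpectation S.x (tT d (n + 1) q n)) =
      Polynomial.C S.E * tr (n + 1) a := by
  induction n using Nat.strong_induction_on with
  | h n ih =>
    suffices key : tr (n + 1) ∘ₗ LinearMap.mulRight ℂ (idemExpectation S.x (tT d (n + 1) q n)) =
        S.E • tr (n + 1) by
      rw [← Polynomial.smul_eq_C_mul]
      exact DFunLike.congr_fun key a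
    refine Y.linearMap_ext (fun c m => ?_) (fun hn b c => ?_)
    · rw [LinearMap.comp_apply, LinearMap.mulRight_apply, LinearMap.smul_apply,
        h.tr_framing_mul_idemExpectation S.x_zero, h.tr_framing_val S.x_zero, S.ESum_eq,
        Polynomial.smul_eq_C_mul, mul_comm (S.x m), map_mul, mul_assoc]
    · obtain ⟨k, rfl⟩ := Nat.exists_eq_add_of_le' hn
      have comm : Commute (idemExpectation S.x (tT d (k + 2) q (k + 1))) (incl d (k + 1) q c) :=
        (idemExpectation_semiconj (t_commute_incl c).symm).symm
      rw [LinearMap.comp_apply, LinearMap.mulRight_apply, LinearMap.smul_apply,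
        Nat.add_sub_cancel]
      calc tr (k + 2) (incl d (k + 1) q b * gT d (k + 2) q k * incl d (k + 1) q c *
            idemExpectation S.x (tT d (k + 2) q (k + 1)))
        _ = tr (k + 2) (incl d (k + 1) q (b * idemExpectation S.x (tT d (k + 1) q k)) *
              gT d (k + 2) q k * incl d (k + 1) q c) := by
            rw [mul_assoc _ (incl d (k + 1) q c), ← comm.eq, ← mul_assoc,
              mul_assoc (incl d (k + 1) q b), gT_mul_idemExpectation, ← mul_assoc, ← map_mul]
        _ = Polynomial.X * tr (k + 1) (c * b * idemExpectation S.x (tT d (k + 1) q k)) := by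
            rw [h.tr_mul_gT_mul, mul_assoc]
        _ = Polynomial.X * (Polynomial.C S.E * tr (k + 1) (c * b)) := by
            rw [ih k k.lt_succ_self]
        _ = S.E • tr (k + 2) (incl d (k + 1) q b * gT d (k + 2) q k * incl d (k + 1) q c) := by
            rw [h.tr_mul_gT_mul, Polynomial.smul_eq_C_mul, mul_left_comm]

theorem tr_mul_eB (h : IsSpecializedTrace S.x q tr) (n : ℕ) (a : Y ℂ d (n + 1) q) :
    tr (n + 2) (incl d (n + 1) q a * eB ℂ d (tT d (n + 2) q n) (tT d (n + 2) q (n + 1))) =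
      Polynomial.C S.E * tr (n + 1) a := by
  rw [h.tr_incl_mul_eB S.x_zero, h.tr_mul_idemExpectation]

theorem tr_mul_invGen (h : IsSpecializedTrace S.x q tr) (n : ℕ) (a : Y ℂ d (n + 1) q) :
    tr (n + 2) (incl d (n + 1) q a *
        invGen d ((q : ℂ) - ((q⁻¹ : ℂˣ) : ℂ)) (gT d (n + 2) q) (tT d (n + 2) q) n) =
      (Polynomial.X - Polynomial.C (((q : ℂ) - ((q⁻¹ : ℂˣ) : ℂ)) * S.E)) * tr (n + 1) a := by
  rw [invGen, mul_sub, mul_smul_comm, map_sub, map_smul, h.tr_markov_gT, h.tr_mul_eB,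
    Polynomial.smul_eq_C_mul, ← mul_assoc, ← map_mul, ← sub_mul]

theorem mirror (h : IsSpecializedTrace S.x q tr) :
    IsSpecializedTrace S.x q⁻¹ fun n =>
      Polynomial.taylor (((q : ℂ) - ((q⁻¹ : ℂˣ) : ℂ)) * S.E) ∘ₗ tr n ∘ₗ
        (Y.mirror ℂ d n q).toLinearMap where
  tr_incl n a := by
    simp only [LinearMap.comp_apply, AlgHom.toLinearMap_apply, Y.mirror_incl, h.tr_incl]
  tr_mul_comm n a b := by
    simp only [LinearMap.comp_apply, AlgHom.toLinearMap_apply, map_mul]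
    rw [h.tr_mul_comm]
  tr_one n := by
    rw [LinearMap.comp_apply, LinearMap.comp_apply, AlgHom.toLinearMap_apply, map_one, h.tr_one,
      Polynomial.taylor_one, map_one]
  tr_markov n a := by
    simp only [LinearMap.comp_apply, AlgHom.toLinearMap_apply, map_mul, Y.mirror_incl]
    rw [← gT_eq n (by omega), Y.mirror_gT n (by omega), h.tr_mul_invGen, Polynomial.taylor_mul,
      map_sub, Polynomial.taylor_X, Polynomial.taylor_C, add_sub_cancel_right]
  tr_framing n a s hs hsd := by
    simp only [LinearMap.comp_apply, AlgHom.toLinearMap_apply, map_mul, map_pow, Y.mirror_incl]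
    rw [Fin.last, ← tT_eq n (by omega), Y.mirror_tT n (by omega), tT_eq n (by omega),
      ← Fin.last, h.tr_framing n _ s hs hsd, Polynomial.taylor_mul, Polynomial.taylor_C]

end IsSpecializedTrace

end Trace

section Theta

variable {d : ℕ} [NeZero d] (S : ESolution d) (q : ℂˣ) {n : ℕ} (α : BraidGroup n)

theorem specializedTrace_mirror (z : ℂ) :
    (specializedTrace S q n (braidToY ℂ d n q (mirror n α))).eval z =
      (specializedTrace S q⁻¹ n (braidToY ℂ d n q⁻¹ α)).eval
        (z - ((q : ℂ) - ((q⁻¹ : ℂˣ) : ℂ)) * S.E) := by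
  rw [← (specializedTrace_spec S q).mirror.unique (specializedTrace_spec S q⁻¹),
    LinearMap.comp_apply, LinearMap.comp_apply, AlgHom.toLinearMap_apply, ← braidToY_mirror,
    Polynomial.taylor_eval, sub_add_cancel]

theorem lam_inv (z : ℂ) :
    lam S q⁻¹ (z - ((q : ℂ) - ((q⁻¹ : ℂˣ) : ℂ)) * S.E) = (lam S q z)⁻¹ := by
  rw [lam, lam, inv_div, inv_inv]
  ring

variable {q}

theorem theta_mirror {z r : ℂ} (hr : r ^ 2 * z = z - ((q : ℂ) - ((q⁻¹ : ℂˣ) : ℂ)) * S.E) :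
    theta S q z r (mirror n α) =
      theta S q⁻¹ (z - ((q : ℂ) - ((q⁻¹ : ℂˣ) : ℂ)) * S.E) r⁻¹ α := by
  have scale : (z - ((q : ℂ) - ((q⁻¹ : ℂˣ) : ℂ)) * S.E) * r⁻¹ = z * r := by
    rw [← hr, mul_right_comm, sq, mul_self_mul_inv, mul_comm]
  rw [theta, theta, specializedTrace_mirror, exponentSum_mirror, scale, inv_zpow']

theorem thetaLam_mirror {l r : ℂ} (hl : l ≠ 0) (hl1 : l ≠ 1) (hr : r ^ 2 = l) :
    thetaLam S q l r (mirror n α) = thetaLam S q⁻¹ l⁻¹ r⁻¹ α := by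
  set v : ℂ := ((q : ℂ) - ((q⁻¹ : ℂˣ) : ℂ)) * S.E with hv
  have sub_ne : 1 - l ≠ 0 := sub_ne_zero.2 hl1.symm
  have z_inv : (((q⁻¹ : ℂˣ) : ℂ) - (((q⁻¹)⁻¹ : ℂˣ) : ℂ)) * S.E / (1 - l⁻¹) = v / (1 - l) - v := by
    rw [inv_inv, ← neg_sub, neg_mul, ← hv]
    field_simp
    ring
  have mul_z : r ^ 2 * (v / (1 - l)) = v / (1 - l) - v := by
    rw [hr]
    field_simp
    ring
  rw [thetaLam, thetaLam, z_inv, theta_mirror S α mul_z]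

end Theta

end YH

end

theorem mainTheorem6 {d : ℕ} [NeZero d] (S : YH.ESolution d) {n : ℕ} (α : YH.BraidGroup n) :
    (∀ (q : ℂˣ) (z r : ℂ), z ≠ 0 → z - ((q : ℂ) - ((q⁻¹ : ℂˣ) : ℂ)) * S.E ≠ 0 →
      r ^ 2 = YH.lam S q z →
      r⁻¹ ^ 2 = YH.lam S q⁻¹ (z - ((q : ℂ) - ((q⁻¹ : ℂˣ) : ℂ)) * S.E) ∧
      YH.theta S q z r (YH.mirror n α) =
        YH.theta S q⁻¹ (z - ((q : ℂ) - ((q⁻¹ : ℂˣ) : ℂ)) * S.E) r⁻¹ α) ∧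
    (∀ (q : ℂˣ) (l r : ℂ), (q : ℂ) ^ 2 ≠ 1 → l ≠ 0 → l ≠ 1 → r ^ 2 = l →
      YH.thetaLam S q l r (YH.mirror n α) = YH.thetaLam S q⁻¹ l⁻¹ r⁻¹ α) := by
  refine ⟨fun q z r hz _ hr => ⟨?_, YH.theta_mirror S α ?_⟩, fun q l r _ hl hl1 hr =>
    YH.thetaLam_mirror S α hl hl1 hr⟩
  · rw [inv_pow, hr, YH.lam_inv]
  · rw [hr, YH.lam, div_mul_cancel₀ _ hz]
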